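/- Let $(R,\mathfrak m,k)$ be a complete regular (Noetherian) local ring of dimension $d\ge 3$ with infinite residue field $k$, and let $n\ge 3$. Write $\mu$ for the minimal number of generators of a finitely generated $R$-module. A proper ideal $I$ of $R$ is called perfect if $R/I$ has finite projective dimension over $R$ and this projective dimension equals the grade of $I$ (the maximal length of an $R$-regular sequence in $I$). Let $J\subseteq \mathfrak m^{n-1}$ be a perfect ideal of $R$ of height $3$ such that $\mu\big((J+\mathfrak m^n)/\mathfrak m^n\big)\ge n$ and $J\nsubseteq yR+\mathfrak m^n$ for every $y\in\mathfrak m$. Assume that one of the following holds: 1. $d>n$; 2. $d=n$ and $\mu\big((J+\mathfrak m^n)/\mathfrak m^n\big)>n$; 3. $d=n$ and $\{r^{n-1} : r\in\mathfrak m\}\nsubseteq J+\mathfrak m^n$. Then there exists $z\in\mathfrak m\setminus\mathfrak m^2$ such that $$\mu\big((J+\mathfrak m^n+zR)/(\mathfrak m^n+zR)\big)\ge n$$ and $J\nsubseteq \mathfrak m^n+(y,z)R$ for every $y\in\mathfrak m$. Moreover, if $d\ne 3$, then $z$ can be chosen so that in addition it is a parameter on $R/J$, that is, $\dim R/(J+zR)=\dim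 R/J-1$. -/

import Mathlib

/-- The grade of an ideal `I` on the ring: the supremum of the lengths of the `R`-regular sequences
consisting of elements of `I`. -/
noncomputable def idealGrade {R : Type*} [CommRing R] (I : Ideal R) : ℕ∞ :=
  ⨆ (rs : List R) (_ : (∀ r ∈ rs, r ∈ I) ∧ RingTheory.Sequence.IsRegular R rs), (rs.length : ℕ∞)

/-- A (proper) ideal `I` is perfect if `R ⧸ I` has finite projective dimension, equal to the
grade of `I`. -/
def IsPerfectIdeal {R : Type*} [CommRing R] (I : Ideal R) : Prop :=
  I ≠ ⊤ ∧
  CategoryTheory.projectiveDimension (ModuleCat.of R (R ⧸ I)) ≠ ⊤ ∧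
  CategoryTheory.projectiveDimension (ModuleCat.of R (R ⧸ I)) = (idealGrade I : WithBot ℕ∞)

/-- `μ((I + K) / K)`: the minimal number of generators of the `R`-module `(I + K) / K`, viewed
as a submodule of `R ⧸ K`. -/
noncomputable def muMod {R : Type*} [CommRing R] (I K : Ideal R) : ℕ :=
  (Submodule.map (Submodule.mkQ K) (I ⊔ K)).spanFinrank

/-- `z` is a parameter on `R ⧸ J` for a local ring `R`: it lies in the maximal ideal and
`dim R/(J + zR) = dim R/J - 1`, that is, the image of `z` in `R ⧸ J` is part of a system of
parameters. -/
def IsParameterOnQuotient {R : Type*} [CommRing R] [IsLocalRing R] (J : Ideal R) (z : R) : Prop :=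
  z ∈ IsLocalRing.maximalIdeal R ∧
  ringKrullDim (R ⧸ (J ⊔ Ideal.span {z})) + 1 = ringKrullDim (R ⧸ J)

/-!
Write `𝔪` for the maximal ideal, `k` for the residue field, `d = m + 1` and `D = n - 1`. A regular
system of parameters identifies the associated graded ring of `R` with `S = k[X_0, …, X_m]`
(`Represents.eq_zero_of_mem_pow_succ`), and everything about `J + 𝔪 ^ n` is a statement about the
space `V ⊆ S_D` of initial forms of `J`: its dimension is at least `n`, and its members have no
common factor. For `z` with linear initial form `ℓ`, the graded ring of `R / (z)` is `S / (ℓ)`, so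
that the conclusion asks that the restriction of `V` to the hyperplane `ℓ = 0` still has dimension
at least `n` and no common factor. Since `k` is infinite, it suffices that this holds for generic
`ℓ = X_m + ∑ c_i X_i`, that is, off the zero locus of a nonzero polynomial in `c` (`Generic`). For
the same reason `z` can be taken outside the minimal primes of `J`, none of which is `𝔪` if `d ≠ 3`;
such a `z` is a parameter on `R / J`.

*No common factor.* `V` contains two relatively prime forms `u`, `v`. As `d ≥ 3`, the generic
hyperplane contains none of the minimal primes of `(u, v)`, all of height at most two. If `u` and `v`
had a common factor `Y` on `ℓ = 0`, a prime minimal over `(Y, ℓ)` would be the top of a chain of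
primes of length three, against Krull's height theorem (`generic_isRelPrime_restrictHyp`).

*Dimension.* Pass to an `n`-dimensional subspace of `V` that contains `u` and `v`, with basis `v_i`.
If its restriction to the generic hyperplane `z = X_m + ∑ t_i X_i` drops in dimension, there is a
relation `∑ a_i v_i = z ^ e g` over `k[t]` with `e > 0` and `z ∤ g`. Let `q` be the largest power of
the characteristic exponent that divides `e`. Comparing coefficients of `s ^ q` after the
substitution `t_j ↦ t_j + s` gives relations whose right hand sides are
`z ^ (e - q) ((e / q) X_j ^ q g + z ^ q g_j)`. Together with the first one they are `d` linearly
independent relations, so `n = d`, and by Cramer's rule a multiple of every `v_i` is in the ideal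
`z ^ (e - q) (z, g)`. As the restrictions of the `v_i` have no common factor, `e = q` and `g` is
constant, so that `D = q` and all `X_j ^ D` are in the span of the `v_i`
(`pow_mem_span_of_pow_mul_eq_sum`). Then so are all `D`-th powers of linear forms, since
`D` is a power of the characteristic exponent. The three cases of the hypothesis
are the ways to exclude this, the second one by a suitable choice of the subspace
(`generic_restrictHyp_linearSystem`).
-/

open MvPolynomial Module

/-! ### Generic points and restriction to hyperplanes -/

/-- A property of points of affine `m`-space over `k` holds generically if it holds off the zero
locus of some nonzero polynomial. -/
def Generic {k : Type*} [CommRing k] {m : ℕ} (Q : (Fin m → k) → Prop) : Prop :=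
  ∃ P : MvPolynomial (Fin m) k, P ≠ 0 ∧ ∀ c, eval c P ≠ 0 → Q c

namespace Generic

variable {k : Type*} [Field k] {m : ℕ} {Q Q' : (Fin m → k) → Prop}

lemma mono (h : Generic Q) (hQ : ∀ c, Q c → Q' c) : Generic Q' := by
  obtain ⟨P, hP, h⟩ := h
  exact ⟨P, hP, fun c hc => hQ c (h c hc)⟩

lemma and (h : Generic Q) (h' : Generic Q') : Generic fun c => Q c ∧ Q' c := by
  obtain ⟨P, hP, h⟩ := h
  obtain ⟨P', hP', h'⟩ := h'
  refine ⟨P * P', mul_ne_zero hP hP', fun c hc => ?_⟩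
  rw [map_mul] at hc
  exact ⟨h c (left_ne_zero_of_mul hc), h' c (right_ne_zero_of_mul hc)⟩

lemma forall_mem_finite {ι : Type*} {s : Set ι} (hs : s.Finite) {Q : ι → (Fin m → k) → Prop}
    (h : ∀ i ∈ s, Generic (Q i)) : Generic fun c => ∀ i ∈ s, Q i c := by
  choose! P hP h using h
  refine ⟨∏ i ∈ hs.toFinset, P i, Finset.prod_ne_zero_iff.2 fun i hi => hP i (by simpa using hi),
    fun c hc i hi => h i hi c ?_⟩
  rw [map_prod, Finset.prod_ne_zero_iff] at hc
  exact hc i (by simpa using hi)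

lemma eval_ne_zero {P : MvPolynomial (Fin m) k} (hP : P ≠ 0) : Generic fun c => eval c P ≠ 0 :=
  ⟨P, hP, fun _ h => h⟩

lemma exists_point [Infinite k] (h : Generic Q) : ∃ c, Q c := by
  obtain ⟨P, hP, h⟩ := h
  by_contra! hQ
  exact hP (MvPolynomial.funext fun c => by simpa using fun hc => hQ c (h c hc))

end Generic

/-- The point `(c, 1)` avoids a proper subspace for generic `c`. -/
lemma generic_snoc_one_notMem {k : Type*} [Field k] {m : ℕ}
    (U : Submodule k (Fin (m + 1) → k)) (hU : U ≠ ⊤) :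
    Generic fun c : Fin m → k => (Fin.snoc c 1 : Fin (m + 1) → k) ∉ U := by
  obtain ⟨f, hf, hUf⟩ := Submodule.exists_le_ker_of_lt_top U hU.lt_top
  set ℓ : Fin (m + 1) → k := fun i => f (Pi.single i 1) with hℓ
  have hfapp : ∀ v, f v = ∑ i, v i * ℓ i := by
    intro v
    rw [LinearMap.pi_apply_eq_sum_univ f v]
    refine Finset.sum_congr rfl fun i _ => ?_
    rw [smul_eq_mul, hℓ]
    congr 2
    ext j
    simp [Pi.single_apply, eq_comm]
  refine ⟨C (ℓ (Fin.last m)) + ∑ i : Fin m, C (ℓ i.castSucc) * X i, ?_, ?_⟩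
  · intro h0
    apply hf
    have hlast : ℓ (Fin.last m) = 0 := by
      have := congrArg (eval 0) h0
      simpa using this
    have hcs : ∀ j : Fin m, ℓ j.castSucc = 0 := by
      intro j
      have := congrArg (eval (Pi.single j 1)) h0
      simpa [hlast, Pi.single_apply] using this
    ext i
    refine Fin.lastCases ?_ (fun j => ?_) i
    · simpa [hℓ] using hlast
    · simpa [hℓ] using hcs j
  · intro c hc hmem
    apply hc
    have := hUf hmem
    rw [LinearMap.mem_ker, hfapp, Fin.sum_univ_castSucc] at this
    simp only [Fin.snoc_castSucc, Fin.snoc_last, one_mul] at this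
    simp only [map_add, eval_C, map_sum, map_mul, eval_X]
    rw [← this, add_comm]
    congr 1
    exact Finset.sum_congr rfl fun i _ => mul_comm _ _

section Restriction

variable {A : Type*} [CommRing A] {m : ℕ}

/-- The linear form `X_m + c_0 X_0 + ⋯ + c_{m-1} X_{m-1}`. -/
noncomputable def monicForm (c : Fin m → A) : MvPolynomial (Fin (m + 1)) A :=
  X (Fin.last m) + ∑ i, C (c i) * X i.castSucc

/-- Restriction of polynomials to the hyperplane `monicForm c = 0`, on which the first `m`
variables are coordinates. -/
noncomputable def restrictHyp (c : Fin m → A) :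
    MvPolynomial (Fin (m + 1)) A →ₐ[A] MvPolynomial (Fin m) A :=
  aeval (Fin.lastCases (-∑ i, C (c i) * X i) X)

@[simp] lemma restrictHyp_X_castSucc (c : Fin m → A) (i : Fin m) :
    restrictHyp c (X i.castSucc) = X i := by simp [restrictHyp]

lemma restrictHyp_X_last (c : Fin m → A) :
    restrictHyp c (X (Fin.last m)) = -∑ i, C (c i) * X i := by simp [restrictHyp]

@[simp] lemma restrictHyp_C (c : Fin m → A) (a : A) : restrictHyp c (C a) = C a := by
  simp [restrictHyp]

@[simp] lemma restrictHyp_monicForm (c : Fin m → A) : restrictHyp c (monicForm c) = 0 := by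
  simp [monicForm, restrictHyp_X_last]

lemma restrictHyp_rename (c : Fin m → A) (G : MvPolynomial (Fin m) A) :
    restrictHyp c (rename Fin.castSucc G) = G := by
  rw [restrictHyp, aeval_rename]
  convert aeval_X_left_apply G
  ext i
  simp

lemma monicForm_dvd_sub_rename_restrictHyp (c : Fin m → A) (F : MvPolynomial (Fin (m + 1)) A) :
    monicForm c ∣ F - rename Fin.castSucc (restrictHyp c F) := by
  rw [← Ideal.mem_span_singleton]
  have key : (Ideal.Quotient.mkₐ A (Ideal.span {monicForm c})) =
      ((Ideal.Quotient.mkₐ A (Ideal.span {monicForm c})).comp (rename Fin.castSucc)).comp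
        (restrictHyp c) := by
    apply MvPolynomial.algHom_ext
    intro i
    refine Fin.lastCases ?_ (fun j => ?_) i
    · rw [AlgHom.comp_apply, AlgHom.comp_apply, restrictHyp_X_last, Ideal.Quotient.mkₐ_eq_mk,
        Ideal.Quotient.eq]
      simp only [map_neg, sub_neg_eq_add, map_sum, map_mul, rename_C, rename_X]
      exact Ideal.subset_span rfl
    · simp
  have := DFunLike.congr_fun key F
  simpa only [AlgHom.comp_apply, Ideal.Quotient.mkₐ_eq_mk, Ideal.Quotient.eq] using this

lemma monicForm_dvd_iff (c : Fin m → A) (F : MvPolynomial (Fin (m + 1)) A) :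
    monicForm c ∣ F ↔ restrictHyp c F = 0 := by
  constructor
  · rintro ⟨G, rfl⟩
    simp
  · intro h
    simpa [h] using monicForm_dvd_sub_rename_restrictHyp c F

lemma map_restrictHyp {B : Type*} [CommRing B] (f : A →+* B) (c : Fin m → A)
    (F : MvPolynomial (Fin (m + 1)) A) :
    map f (restrictHyp c F) = restrictHyp (f ∘ c) (map f F) := by
  have : (map f).comp (restrictHyp c).toRingHom =
      (restrictHyp (f ∘ c)).toRingHom.comp (map f) := by
    apply MvPolynomial.ringHom_ext
    · intro a; simp
    · intro i
      refine Fin.lastCases ?_ (fun j => ?_) i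
      · simp [restrictHyp_X_last]
      · simp
  exact DFunLike.congr_fun this F

lemma map_monicForm {B : Type*} [CommRing B] (f : A →+* B) (c : Fin m → A) :
    map f (monicForm c) = monicForm (f ∘ c) := by
  simp [monicForm]

lemma isHomogeneous_monicForm (c : Fin m → A) : (monicForm c).IsHomogeneous 1 :=
  (isHomogeneous_X _ _).add (IsHomogeneous.sum _ _ _ fun _ _ => isHomogeneous_C_mul_X _ _)

lemma MvPolynomial.IsHomogeneous.restrictHyp {F : MvPolynomial (Fin (m + 1)) A} {n : ℕ}
    (hF : F.IsHomogeneous n) (c : Fin m → A) : (restrictHyp c F).IsHomogeneous n := by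
  have := hF.aeval (Fin.lastCases (-∑ i, C (c i) * X i) X : Fin (m + 1) → MvPolynomial (Fin m) A)
    (n := 1) (by
      intro i
      refine Fin.lastCases ?_ (fun j => ?_) i
      · simpa using (IsHomogeneous.sum _ _ _ fun _ _ => isHomogeneous_C_mul_X _ _).neg
      · simpa using isHomogeneous_X _ _)
  rwa [one_mul] at this

lemma monicForm_ne_zero [Nontrivial A] (c : Fin m → A) : monicForm c ≠ 0 := by
  intro h
  have := congrArg (eval (Pi.single (Fin.last m) 1)) h
  simp [monicForm, Fin.castSucc_ne_last] at this

lemma prime_monicForm [IsDomain A] (c : Fin m → A) : Prime (monicForm c) := by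
  refine ⟨monicForm_ne_zero c, fun h => ?_, fun F G h => ?_⟩
  · have := h.map (restrictHyp c)
    simp at this
  · simpa [monicForm_dvd_iff] using h

end Restriction

/-- Top-degree components multiply; in particular, if `p` divides a form over a domain, then so does
the top-degree component of `p`. -/
lemma homogeneousComponent_mul_of_le {σ A : Type*} [CommRing A] {p q : MvPolynomial σ A} {a b : ℕ}
    (hp : p.totalDegree ≤ a) (hq : q.totalDegree ≤ b) :
    homogeneousComponent (a + b) (p * q) =
      homogeneousComponent a p * homogeneousComponent b q := by
  classical
  conv_lhs => rw [← sum_homogeneousComponent p, ← sum_homogeneousComponent q]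
  rw [Finset.sum_mul_sum, map_sum]
  simp only [map_sum]
  have hcomp : ∀ i j, homogeneousComponent (a + b)
      (homogeneousComponent i p * homogeneousComponent j q) =
      if a + b = i + j then homogeneousComponent i p * homogeneousComponent j q else 0 := by
    intro i j
    exact homogeneousComponent_of_mem
      ((homogeneousComponent_isHomogeneous i p).mul (homogeneousComponent_isHomogeneous j q))
  simp only [hcomp]
  rw [Finset.sum_eq_single a, Finset.sum_eq_single b]
  · simp
  · intro j hj hjb
    rw [if_neg (by omega)]
  · intro hb
    rw [if_pos rfl, homogeneousComponent_eq_zero b q (by simpa using hb), mul_zero]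
  · intro i hi hia
    refine Finset.sum_eq_zero fun j hj => if_neg ?_
    simp only [Finset.mem_range] at hi hj
    omega
  · intro ha
    refine Finset.sum_eq_zero fun j hj => ?_
    rw [homogeneousComponent_eq_zero a p (by simpa using ha), zero_mul, ite_self]

/-! ### Specialisation, relatively prime forms and their generic restrictions -/

/-- Linear independence of a finite family of polynomials over `k[t]` survives specialisation of
`t` to a generic point: a left inverse over the fraction field has a common denominator. -/
lemma generic_linearIndependent_map {k σ ι : Type*} [Field k] [Finite ι] {m : ℕ}
    {u : ι → MvPolynomial σ (MvPolynomial (Fin m) k)}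
    (hu : LinearIndependent (MvPolynomial (Fin m) k) u) :
    Generic fun c : Fin m → k => LinearIndependent k fun i => map (eval c) (u i) := by
  classical
  cases nonempty_fintype ι
  set A := MvPolynomial (Fin m) k
  let K := FractionRing A
  let j : MvPolynomial σ A →ₗ[A] MvPolynomial σ K := (mapAlgHom (Algebra.ofId A K)).toLinearMap
  have hj : ∀ F, j F = map (algebraMap A K) F := fun F => rfl
  have hjinj : Function.Injective j :=
    map_injective (algebraMap A K) (IsFractionRing.injective A K)
  have huK : LinearIndependent K (j ∘ u) :=
    (LinearIndependent.iff_fractionRing (R := A) (K := K)).1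
      (hu.map' j (LinearMap.ker_eq_bot.2 hjinj))
  obtain ⟨g, hg⟩ := (Finsupp.linearCombination K (j ∘ u)).exists_leftInverse_of_injective
    (LinearMap.ker_eq_bot.2 huK)
  have hgu : ∀ i, g (j (u i)) = Finsupp.single i 1 := by
    intro i
    have := LinearMap.congr_fun hg (Finsupp.single i 1)
    simpa using this
  let T : Finset (σ →₀ ℕ) := Finset.univ.biUnion fun i => (u i).support
  obtain ⟨b, hb⟩ := IsLocalization.exist_integer_multiples_of_finite (nonZeroDivisors A)
    (fun p : T × ι => g (monomial p.1.1 1) p.2)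
  choose B hB using hb
  have hsum : ∀ i l, ∑ μ : T, coeff μ.1 (u i) * B (μ, l) = if i = l then (b : A) else 0 := by
    intro i l
    apply IsFractionRing.injective A K
    have hexp : j (u i) = ∑ μ : T, algebraMap A K (coeff μ.1 (u i)) • monomial μ.1 (1 : K) := by
      rw [hj, Finset.sum_coe_sort T fun μ => algebraMap A K (coeff μ (u i)) • monomial μ (1 : K)]
      conv_lhs => rw [(u i).as_sum, map_sum]
      refine Finset.sum_subset_zero_on_sdiff
        (Finset.subset_biUnion_of_mem (fun i => (u i).support) (Finset.mem_univ i)) ?_ ?_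
      · intro μ hμ
        have : coeff μ (u i) = 0 := by simpa using (Finset.mem_sdiff.1 hμ).2
        rw [this, map_zero, zero_smul]
      · intro μ hμ
        rw [map_monomial, smul_monomial, smul_eq_mul, mul_one]
    have h1 := hgu i
    rw [hexp, map_sum] at h1
    have h2 := congrArg (fun f => f l) h1
    simp only [map_smul, Finsupp.coe_finsetSum, Finset.sum_apply, Finsupp.smul_apply,
      smul_eq_mul, Finsupp.single_apply] at h2
    have h3 : ∑ μ : T, algebraMap A K (coeff μ.1 (u i)) * algebraMap A K (B (μ, l)) =
        algebraMap A K b * ∑ μ : T, algebraMap A K (coeff μ.1 (u i)) * g (monomial μ.1 1) l := by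
      rw [Finset.mul_sum]
      refine Finset.sum_congr rfl fun μ _ => ?_
      rw [hB, Algebra.smul_def]
      ring
    rw [map_sum]
    simp only [map_mul]
    rw [h3, h2]
    split_ifs <;> simp
  refine ⟨b, nonZeroDivisors.ne_zero b.2, fun c hc => ?_⟩
  refine Fintype.linearIndependent_iff.2 ?_
  intro lam hlam l
  have hcoef : ∀ μ, ∑ i, lam i * eval c (coeff μ (u i)) = 0 := by
    intro μ
    have := congrArg (coeff μ) hlam
    simpa [coeff_sum, coeff_map] using this
  have : lam l * eval c (b : A) = 0 := by
    calc lam l * eval c (b : A)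
        = ∑ i, lam i * eval c (if i = l then (b : A) else 0) := by
          simp [apply_ite (eval c)]
      _ = ∑ i, lam i * ∑ μ : T, eval c (coeff μ.1 (u i)) * eval c (B (μ, l)) := by
          simp only [← hsum, map_sum, map_mul]
      _ = ∑ μ : T, (∑ i, lam i * eval c (coeff μ.1 (u i))) * eval c (B (μ, l)) := by
          simp only [Finset.mul_sum, Finset.sum_mul]
          rw [Finset.sum_comm]
          simp only [mul_assoc]
      _ = 0 := by simp [hcoef]
  exact (mul_eq_zero.1 this).resolve_right hc

/-- A linear system of forms without a common factor contains two relatively prime forms. -/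
lemma exists_isRelPrime_of_forall_not_dvd {k σ : Type*} [Field k] [Infinite k] {D : ℕ}
    {V : Submodule k (MvPolynomial σ k)} (hV : ∀ F ∈ V, F.IsHomogeneous D) (hV0 : V ≠ ⊥)
    (hdvd : ∀ e ≠ 0, ∀ Y : MvPolynomial σ k, Y.IsHomogeneous e → ∃ F ∈ V, ¬ Y ∣ F) :
    ∃ u ∈ V, ∃ v ∈ V, u ≠ 0 ∧ IsRelPrime u v := by
  classical
  obtain ⟨u, hu, hu0⟩ := Submodule.exists_mem_ne_zero_of_ne_bot hV0
  -- the members of `V` divisible by `p`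
  let U : MvPolynomial σ k → Submodule k V := fun p =>
    ((Ideal.span {p}).restrictScalars k).comap V.subtype
  have hU : ∀ p (v : V), v ∈ U p ↔ p ∣ (v : MvPolynomial σ k) := by
    intro p v
    simp [U, Ideal.mem_span_singleton]
  have hUtop : ∀ p, Prime p → U p ≠ ⊤ := by
    intro p hp htop
    -- otherwise the top component of `p`, a form, would divide all of `V` as well
    obtain ⟨F, hF, hpF⟩ := hdvd p.totalDegree (by
      intro h
      rw [totalDegree_eq_zero_iff_eq_C] at h
      refine hp.not_isUnit ?_
      rw [h]
      refine IsUnit.map C (isUnit_iff_ne_zero.2 fun h0 => ?_)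
      rw [h0, C_0] at h
      exact hp.ne_zero h) (homogeneousComponent p.totalDegree p)
      (homogeneousComponent_isHomogeneous _ _)
    apply hpF
    obtain ⟨q, hq⟩ := (hU p ⟨F, hF⟩).1 (htop ▸ Submodule.mem_top)
    simp only at hq
    rcases eq_or_ne F 0 with rfl | hF0
    · exact dvd_zero _
    have hq0 : q ≠ 0 := by rintro rfl; simp at hq; exact hF0 hq
    have hdeg : D = p.totalDegree + q.totalDegree := by
      rw [← totalDegree_mul_of_isDomain hp.ne_zero hq0, ← hq, (hV F hF).totalDegree hF0]
    refine ⟨homogeneousComponent q.totalDegree q, ?_⟩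
    rw [← homogeneousComponent_mul_of_le le_rfl le_rfl, ← hq, ← hdeg,
      homogeneousComponent_eq_self (hV F hF)]
  have hcov := Subspace.biUnion_ne_univ_of_top_notMem (k := k) (E := V)
    (s := (UniqueFactorizationMonoid.factors u).toFinset.image U) (by
      simp only [Finset.mem_image, Multiset.mem_toFinset, not_exists, not_and]
      intro p hp
      exact hUtop p (UniqueFactorizationMonoid.prime_of_factor p hp))
  obtain ⟨v, hv⟩ := (Set.ne_univ_iff_exists_notMem _).1 hcov
  simp only [Set.mem_iUnion, Finset.mem_image, Multiset.mem_toFinset, SetLike.mem_coe,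
    not_exists] at hv
  refine ⟨u, hu, v, v.2, hu0, ?_⟩
  intro d hdu hdv
  by_contra hd
  obtain ⟨p, hp, hpd⟩ := WfDvdMonoid.exists_irreducible_factor hd (by
    rintro rfl; exact hu0 (zero_dvd_iff.1 hdu))
  obtain ⟨q, hq, hpq⟩ := UniqueFactorizationMonoid.exists_mem_factors_of_dvd hu0 hp
    (hpd.trans hdu)
  exact hv _ ⟨q, hq, rfl⟩ ((hU q v).2 ((hpq.symm.dvd.trans hpd).trans hdv))

/-- A prime containing all the variables has height at least the number of variables. -/
lemma le_height_of_forall_X_mem {k : Type*} [Field k] {n : ℕ}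
    {P : Ideal (MvPolynomial (Fin n) k)} [P.IsPrime] (hP : ∀ i, X i ∈ P) :
    (n : ℕ∞) ≤ P.height := by
  -- the primes generated by initial segments of the variables, as kernels
  let φ : ℕ → MvPolynomial (Fin n) k →ₐ[k] MvPolynomial (Fin n) k := fun j =>
    aeval fun i => if i.val < j then 0 else X i
  let K : ℕ → Ideal (MvPolynomial (Fin n) k) := fun j => RingHom.ker (φ j)
  have hK : ∀ j, (K j).IsPrime := fun j => RingHom.ker_isPrime _
  have hle : ∀ j, K j ≤ K (j + 1) := by
    intro j F hF
    have : φ (j + 1) = (φ (j + 1)).comp (φ j) := by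
      apply MvPolynomial.algHom_ext
      intro i
      simp only [φ, AlgHom.comp_apply, aeval_X]
      by_cases h : i.val < j
      · simp [h, h.trans (Nat.lt_succ_self j)]
      · simp [h]
    rw [RingHom.mem_ker] at hF ⊢
    rw [this, AlgHom.comp_apply, hF, map_zero]
  have hlt : ∀ j, j < n → K j < K (j + 1) := by
    intro j hj
    refine lt_of_le_of_ne (hle j) fun h => ?_
    have h1 : X ⟨j, hj⟩ ∈ K (j + 1) := by simp [K, φ, RingHom.mem_ker]
    rw [← h] at h1
    simp [K, φ, RingHom.mem_ker] at h1
  have hht : ∀ j, j ≤ n → (j : ℕ∞) ≤ (K j).height := by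
    intro j
    induction j with
    | zero => simp
    | succ j ih =>
      intro hj
      have := Ideal.height_add_one_le_of_lt_of_isPrime (hlt j hj)
      refine le_trans ?_ this
      push_cast
      gcongr
      exact ih (by omega)
  refine (hht n le_rfl).trans (Ideal.height_mono fun F hF => ?_)
  have : (Ideal.Quotient.mkₐ k P) = (Ideal.Quotient.mkₐ k P).comp (φ n) := by
    apply MvPolynomial.algHom_ext
    intro i
    simp only [φ, AlgHom.comp_apply, aeval_X, i.2, if_true, map_zero]
    exact Ideal.Quotient.eq_zero_iff_mem.2 (hP i)
  have h2 := DFunLike.congr_fun this F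
  rw [AlgHom.comp_apply, (RingHom.mem_ker.1 hF : φ n F = 0), map_zero] at h2
  exact Ideal.Quotient.eq_zero_iff_mem.1 h2

lemma monicForm_eq_sum {A : Type*} [CommRing A] {m : ℕ} (c : Fin m → A) :
    monicForm c = ∑ i, C ((Fin.snoc c 1 : Fin (m + 1) → A) i) * X i := by
  simp [monicForm, Fin.sum_univ_castSucc, add_comm]

/-- Two relatively prime polynomials in at least three variables stay relatively prime on a generic
hyperplane: it suffices that the hyperplane contains no component of the codimension two locus where
both vanish. -/
lemma generic_isRelPrime_restrictHyp {k : Type*} [Field k] {m : ℕ} (hm : 2 ≤ m)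
    {u v : MvPolynomial (Fin (m + 1)) k} (hu : u ≠ 0) (huv : IsRelPrime u v) :
    Generic fun c => IsRelPrime (restrictHyp c u) (restrictHyp c v) := by
  classical
  set I : Ideal (MvPolynomial (Fin (m + 1)) k) := Ideal.span {u, v} with hI
  have hgen : Generic fun c : Fin m → k => ∀ P ∈ I.minimalPrimes, monicForm c ∉ P := by
    refine Generic.forall_mem_finite (Ideal.finite_minimalPrimes_of_isNoetherianRing _ I)
      fun P hP => ?_
    have : P.IsPrime := hP.1.1
    let L : (Fin (m + 1) → k) →ₗ[k] MvPolynomial (Fin (m + 1)) k :=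
      Fintype.linearCombination k X
    have hL : ∀ c : Fin m → k, monicForm c = L (Fin.snoc c 1) := by
      intro c
      simp only [L, Fintype.linearCombination_apply, monicForm_eq_sum, smul_eq_C_mul]
    refine (generic_snoc_one_notMem ((P.restrictScalars k).comap L) ?_).mono fun c hc => ?_
    · intro htop
      have hX : ∀ i, X i ∈ P := by
        intro i
        have : Pi.single i 1 ∈ (P.restrictScalars k).comap L := htop ▸ Submodule.mem_top
        simpa [L, Fintype.linearCombination_apply_single] using this
      have h1 := le_height_of_forall_X_mem hX
      have h2 := Ideal.height_le_card_of_mem_minimalPrimes_span (Set.toFinite {u, v}) hP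
      have h3 : ({u, v} : Set (MvPolynomial (Fin (m + 1)) k)).ncard ≤ 2 :=
        (Set.ncard_insert_le u {v}).trans (by simp)
      have h4 : ((m + 1 : ℕ) : ℕ∞) ≤ (2 : ℕ) := h1.trans (h2.trans (by exact_mod_cast h3))
      have h5 : m + 1 ≤ 2 := by exact_mod_cast h4
      omega
    · rw [hL]
      simpa using hc
  refine hgen.mono fun c hc Y hYu hYv => ?_
  by_contra hY
  have hmem : ∀ F, Y ∣ restrictHyp c F → F ∈ Ideal.span {rename Fin.castSucc Y, monicForm c} := by
    rintro F ⟨G, hG⟩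
    obtain ⟨H, hH⟩ := monicForm_dvd_sub_rename_restrictHyp c F
    rw [Ideal.mem_span_pair]
    refine ⟨rename Fin.castSucc G, H, ?_⟩
    rw [hG, map_mul] at hH
    linear_combination -hH
  obtain ⟨Q, hQ⟩ := Ideal.nonempty_minimalPrimes
    (I := Ideal.span {rename Fin.castSucc Y, monicForm c}) (by
      rw [Ne, Ideal.eq_top_iff_one, Ideal.mem_span_pair]
      rintro ⟨a, b, hab⟩
      have := congrArg (restrictHyp c) hab
      simp only [map_add, map_mul, restrictHyp_rename, restrictHyp_monicForm, mul_zero, add_zero,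
        map_one] at this
      exact hY (IsUnit.of_mul_eq_one_right _ this))
  have hQp : Q.IsPrime := hQ.1.1
  have hQht : Q.height ≤ (2 : ℕ) :=
    (Ideal.height_le_card_of_mem_minimalPrimes_span (Set.toFinite _) hQ).trans
      (by exact_mod_cast (Set.ncard_insert_le _ _).trans (by simp))
  have hIQ : I ≤ Q := by
    rw [hI, Ideal.span_le, Set.pair_subset_iff]
    exact ⟨hQ.1.2 (hmem u hYu), hQ.1.2 (hmem v hYv)⟩
  obtain ⟨P, hP, hPQ⟩ := Ideal.exists_minimalPrimes_le hIQ
  have hPp : P.IsPrime := hP.1.1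
  have hIP : u ∈ P ∧ v ∈ P := ⟨hP.1.2 (Ideal.subset_span (by simp)),
    hP.1.2 (Ideal.subset_span (by simp))⟩
  have hPQ' : P < Q := lt_of_le_of_ne hPQ fun h =>
    hc P hP (h ▸ hQ.1.2 (Ideal.subset_span (by simp)))
  obtain ⟨p, hpP, hp⟩ := hPp.exists_mem_prime_of_ne_bot fun h => hu (by simpa [h] using hIP.1)
  have hpp : (Ideal.span {p}).IsPrime := (Ideal.span_singleton_prime hp.ne_zero).2 hp
  have hpP' : Ideal.span {p} < P := by
    refine lt_of_le_of_ne ((Ideal.span_singleton_le_iff_mem _).2 hpP) fun h => hp.not_isUnit ?_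
    rw [← h, Ideal.mem_span_singleton, Ideal.mem_span_singleton] at hIP
    exact huv hIP.1 hIP.2
  have h0p : (⊥ : Ideal (MvPolynomial (Fin (m + 1)) k)) < Ideal.span {p} := by
    rw [bot_lt_iff_ne_bot, Ne, Ideal.span_singleton_eq_bot]
    exact hp.ne_zero
  have h1 := Ideal.height_add_one_le_of_lt_of_isPrime h0p
  have h2 := Ideal.height_add_one_le_of_lt_of_isPrime hpP'
  have h3 := Ideal.height_add_one_le_of_lt_of_isPrime hPQ'
  have h4 : (0 + 1 + 1 + 1 : ℕ∞) ≤ (2 : ℕ) :=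
    le_trans (by gcongr; refine le_trans ?_ h2; gcongr; refine le_trans ?_ h1; gcongr; simp)
      (h3.trans hQht)
  exact absurd h4 (by decide)

/-! ### Shifting the parameters of the generic hyperplane -/

/-- The coefficient of `s ^ q` in `(z + s x) ^ e * G(s)`, where `q` is the exact power of the
characteristic exponent dividing `e`; this replaces the `q`-th derivative in characteristic `p`. -/
lemma coeff_linear_pow_mul {B : Type*} [CommRing B] {p : ℕ} [ExpChar B p] (z x : B)
    (G : Polynomial B) (s e : ℕ) :
    ((Polynomial.C z + Polynomial.C x * Polynomial.X) ^ (p ^ s * e) * G).coeff (p ^ s) =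
      z ^ (p ^ s * e) * G.coeff (p ^ s) +
        e * z ^ (p ^ s * (e - 1)) * x ^ (p ^ s) * G.coeff 0 := by
  have hq : 0 < p ^ s := pow_pos (expChar_pos B p) s
  set q := p ^ s
  obtain ⟨K, hK⟩ := Polynomial.powAddExpansion (Polynomial.C (z ^ q))
    (Polynomial.C (x ^ q) * Polynomial.X ^ q) e
  have h1 : (Polynomial.C z + Polynomial.C x * Polynomial.X) ^ q =
      Polynomial.C (z ^ q) + Polynomial.C (x ^ q) * Polynomial.X ^ q := by
    rw [add_pow_expChar_pow, mul_pow, Polynomial.C_pow, Polynomial.C_pow]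
  have h2 : (Polynomial.C z + Polynomial.C x * Polynomial.X) ^ (q * e) * G =
      Polynomial.C (z ^ (q * e)) * G +
        (Polynomial.C (e * z ^ (q * (e - 1)) * x ^ q) * G) * Polynomial.X ^ q +
        (K * Polynomial.C (x ^ q) ^ 2 * G) * Polynomial.X ^ (q + q) := by
    rw [pow_mul, h1, hK]
    simp only [Polynomial.C_mul, Polynomial.C_pow, pow_mul, map_natCast]
    ring
  rw [h2, Polynomial.coeff_add, Polynomial.coeff_add, Polynomial.coeff_C_mul,
    Polynomial.coeff_mul_X_pow', Polynomial.coeff_mul_X_pow', if_pos le_rfl, if_neg (by omega),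
    Nat.sub_self, Polynomial.coeff_C_mul, add_zero]

lemma sum_pow_expChar_pow {B ι : Type*} [CommRing B] (p : ℕ) [ExpChar B p] (s : ℕ) (t : Finset ι)
    (f : ι → B) : (∑ i ∈ t, f i) ^ p ^ s = ∑ i ∈ t, f i ^ p ^ s := by
  simpa only [iterateFrobenius_def] using map_sum (iterateFrobenius B p s) f t

lemma exists_eq_expChar_pow_mul (k : Type*) [Field k] (p : ℕ) [hp : ExpChar k p] {e : ℕ}
    (he : e ≠ 0) : ∃ s e', e = p ^ s * e' ∧ (e' : k) ≠ 0 := by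
  rcases hp with _ | hp
  · exact ⟨0, e, by simp, by exact_mod_cast he⟩
  · obtain ⟨s, e', h, rfl⟩ := Nat.exists_eq_pow_mul_and_not_dvd he p hp.ne_one
    exact ⟨s, e', rfl, by rwa [Ne, CharP.cast_eq_zero_iff k p]⟩

section Shift

variable {k : Type*} [Field k] {m : ℕ} {σ : Type*}

/-- The substitution `t_j ↦ t_j + s` on `k[t]`. -/
noncomputable def shiftCoeff (j : Fin m) :
    MvPolynomial (Fin m) k →ₐ[k] Polynomial (MvPolynomial (Fin m) k) :=
  aeval fun i => Polynomial.C (X i) + if i = j then Polynomial.X else 0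

/-- The substitution `t_j ↦ t_j + s` on `k[t][x]`. -/
noncomputable def shiftParam (j : Fin m) :
    MvPolynomial σ (MvPolynomial (Fin m) k) →+*
      Polynomial (MvPolynomial σ (MvPolynomial (Fin m) k)) :=
  eval₂Hom ((Polynomial.mapRingHom C).comp (shiftCoeff j).toRingHom) fun i => Polynomial.C (X i)

lemma shiftCoeff_C (j : Fin m) (r : k) : shiftCoeff j (C r) = Polynomial.C (C r) := by
  rw [← algebraMap_eq, AlgHom.commutes, Polynomial.algebraMap_apply]

lemma shiftParam_C (j : Fin m) (a : MvPolynomial (Fin m) k) :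
    shiftParam (σ := σ) j (C a) = (shiftCoeff j a).map C := by
  simp [shiftParam]

@[simp] lemma shiftParam_X (j : Fin m) (i : σ) :
    shiftParam (k := k) j (X i) = Polynomial.C (X i) := by
  simp [shiftParam]

@[simp] lemma shiftParam_map_C (j : Fin m) (v : MvPolynomial σ k) :
    shiftParam j (map C v) = Polynomial.C (map C v) := by
  have : (shiftParam (k := k) (σ := σ) j).comp (map C) = Polynomial.C.comp (map C) := by
    apply MvPolynomial.ringHom_ext
    · intro r
      simp only [RingHom.comp_apply, map_C, shiftParam_C, shiftCoeff_C, Polynomial.map_C]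
    · intro i
      simp
  exact DFunLike.congr_fun this v

lemma coeff_zero_shiftParam (j : Fin m) (F : MvPolynomial σ (MvPolynomial (Fin m) k)) :
    (shiftParam j F).coeff 0 = F := by
  have : (Polynomial.constantCoeff.comp (shiftParam (k := k) (σ := σ) j)) = RingHom.id _ := by
    apply MvPolynomial.ringHom_ext
    · intro a
      simp only [RingHom.comp_apply, shiftParam_C, Polynomial.constantCoeff_apply,
        Polynomial.coeff_map, RingHom.id_apply]
      congr 1
      have h : (Polynomial.constantCoeff.comp (shiftCoeff (k := k) j).toRingHom) =
          RingHom.id _ := by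
        apply MvPolynomial.ringHom_ext
        · intro r
          simp
        · intro i
          by_cases hij : i = j <;> simp [shiftCoeff, hij]
      exact DFunLike.congr_fun h a
    · intro i
      simp
  exact DFunLike.congr_fun this F

lemma shiftParam_monicForm (j : Fin m) :
    shiftParam j (monicForm (X : Fin m → MvPolynomial (Fin m) k)) =
      Polynomial.C (monicForm X) + Polynomial.C (X j.castSucc) * Polynomial.X := by
  have h : ∀ i, shiftParam (k := k) (σ := Fin (m + 1)) j (C (X i)) =
      Polynomial.C (C (X i)) + if i = j then Polynomial.X else 0 := by
    intro i
    rw [shiftParam_C]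
    by_cases hij : i = j <;> simp [shiftCoeff, hij]
  rw [monicForm, map_add, map_sum]
  simp only [map_mul, h, shiftParam_X, add_mul, Finset.sum_add_distrib, ite_mul, zero_mul,
    Finset.sum_ite_eq', Finset.mem_univ, if_true, map_add, map_sum]
  ring

end Shift

lemma MvPolynomial.IsHomogeneous.of_mul_left {σ A : Type*} [CommRing A] [IsDomain A]
    {F G : MvPolynomial σ A} {e D : ℕ} (hF : F.IsHomogeneous e) (hFG : (F * G).IsHomogeneous D)
    (hF0 : F ≠ 0) (hG0 : G ≠ 0) : ∃ b, D = e + b ∧ G.IsHomogeneous b := by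
  refine ⟨G.totalDegree, ?_, ?_⟩
  · rw [← hFG.totalDegree (mul_ne_zero hF0 hG0), totalDegree_mul_of_isDomain hF0 hG0,
      hF.totalDegree hF0]
  · have hD : D = e + G.totalDegree := by
      rw [← hFG.totalDegree (mul_ne_zero hF0 hG0), totalDegree_mul_of_isDomain hF0 hG0,
        hF.totalDegree hF0]
    have := homogeneousComponent_mul_of_le (p := F) (q := G) hF.totalDegree_le le_rfl
    rw [← hD, homogeneousComponent_eq_self hFG, homogeneousComponent_eq_self hF] at this
    have hG := homogeneousComponent_isHomogeneous G.totalDegree G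
    rwa [← mul_left_cancel₀ hF0 this] at hG

lemma MvPolynomial.IsHomogeneous.eq_zero_of_isUnit {σ k : Type*} [Field k]
    {F : MvPolynomial σ k} {e : ℕ} (hF : F.IsHomogeneous e) (h : IsUnit F) : e = 0 := by
  obtain ⟨G, hG⟩ := h.exists_right_inv
  have hF0 := h.ne_zero
  have hG0 : G ≠ 0 := by rintro rfl; simp at hG
  have h1 : (F * G).IsHomogeneous 0 := by
    rw [hG]
    exact isHomogeneous_one _ _
  obtain ⟨b, hb, -⟩ := hF.of_mul_left h1 hF0 hG0
  omega

section Constant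

variable {k : Type*} [Field k] {m : ℕ} {σ : Type*}

@[simp] lemma map_eval_map_C (c : Fin m → k) (v : MvPolynomial σ k) :
    map (eval c) (map C v) = v := by
  rw [map_map]
  convert map_id v
  ext r
  simp

@[simp] lemma map_eval_monicForm (c : Fin m → k) :
    map (eval c) (monicForm (X : Fin m → MvPolynomial (Fin m) k)) = monicForm c := by
  rw [map_monicForm]
  congr 1
  ext i
  simp

lemma map_eval_restrictHyp (c : Fin m → k)
    (F : MvPolynomial (Fin (m + 1)) (MvPolynomial (Fin m) k)) :
    map (eval c) (restrictHyp X F) = restrictHyp c (map (eval c) F) := by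
  rw [map_restrictHyp]
  congr 2
  ext i
  simp

lemma sum_C_mul_map_C_eq_zero [Infinite k] {n : ℕ} {v : Fin n → MvPolynomial σ k}
    (hli : LinearIndependent k v) {a : Fin n → MvPolynomial (Fin m) k}
    (h : ∑ i, C (a i) * map C (v i) = 0) : a = 0 := by
  ext1 i
  refine MvPolynomial.funext fun c => ?_
  have h' : ∑ i, eval c (a i) • v i = 0 := by
    have := congrArg (map (eval c)) h
    rw [map_sum, map_zero] at this
    rw [← this]
    refine Finset.sum_congr rfl fun i _ => ?_
    rw [map_mul, map_C, map_eval_map_C, C_mul']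
  rw [Pi.zero_apply, map_zero]
  exact Fintype.linearIndependent_iff.1 hli _ h' i

end Constant

/-! ### Relations on the generic hyperplane -/

section Core

variable {k : Type*} [Field k] {m n : ℕ}

/-- The `A`-linear independence at the heart of the argument: if
`h_j = e x_j ^ q g + z ^ q g_j` and `h = z ^ q g` with `e` and `g` not divisible by the
linear form `z`, then `h_0, …, h_{m-1}, h` are linearly independent. -/
lemma eq_zero_of_sum_mul_eq_zero {A : Type*} [CommRing A] [IsDomain A] {t : Fin m → A}
    {g : MvPolynomial (Fin (m + 1)) A} (hg : ¬ monicForm t ∣ g) {q : ℕ} (hq : q ≠ 0)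
    {e : MvPolynomial (Fin (m + 1)) A} (he : ¬ monicForm t ∣ e)
    {g' : Fin m → MvPolynomial (Fin (m + 1)) A} {lam : Fin m → A} {lam₀ : A}
    (h : ∑ j, C (lam j) * (e * X j.castSucc ^ q * g + monicForm t ^ q * g' j) +
      C lam₀ * (monicForm t ^ q * g) = 0) : (∀ j, lam j = 0) ∧ lam₀ = 0 := by
  rw [monicForm_dvd_iff] at hg he
  have hlam : ∀ j, lam j = 0 := by
    have h1 := congrArg (restrictHyp t) h
    simp only [map_add, map_sum, map_mul, map_pow, restrictHyp_C, restrictHyp_monicForm,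
      restrictHyp_X_castSucc, zero_pow hq, zero_mul, mul_zero, add_zero, map_zero] at h1
    have h2 : restrictHyp t e * restrictHyp t g * ∑ j, C (lam j) * X j ^ q = 0 := by
      rw [← h1, Finset.mul_sum]
      exact Finset.sum_congr rfl fun j _ => by ring
    have h3 := (mul_eq_zero.1 h2).resolve_left (mul_ne_zero he hg)
    intro j
    have h4 := congrArg (eval (Pi.single j 1)) h3
    simpa [Pi.single_apply, ite_pow, zero_pow hq] using h4
  refine ⟨hlam, ?_⟩
  have hg0 : g ≠ 0 := by rintro rfl; simp at hg
  simpa [hlam, hg0, monicForm_ne_zero, pow_eq_zero_iff hq] using h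

/-- The coefficients of `s ^ q` in the shifts `t_j ↦ t_j + s` of the relation
`∑ a_i v_i = z ^ e g`, where `e = q e'` and `q = p ^ s`. -/
lemma exists_shifted_relations (p : ℕ) [ExpChar k p] {v : Fin n → MvPolynomial (Fin (m + 1)) k}
    {a : Fin n → MvPolynomial (Fin m) k} {s e' : ℕ} (he' : e' ≠ 0)
    {g : MvPolynomial (Fin (m + 1)) (MvPolynomial (Fin m) k)}
    (hag : ∑ i, C (a i) * map C (v i) = monicForm X ^ (p ^ s * e') * g) :
    ∃ (b : Fin m → Fin n → MvPolynomial (Fin m) k)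
      (g' : Fin m → MvPolynomial (Fin (m + 1)) (MvPolynomial (Fin m) k)),
      (∀ j, ∑ i, C (b j i) * map C (v i) = monicForm X ^ (p ^ s * (e' - 1)) *
        ((e' : MvPolynomial (Fin (m + 1)) (MvPolynomial (Fin m) k)) *
          X j.castSucc ^ p ^ s * g + monicForm X ^ p ^ s * g' j)) ∧
      ∀ γ, g = C γ → ∀ j, ∃ κ, g' j = C κ := by
  have : ExpChar (MvPolynomial (Fin (m + 1)) (MvPolynomial (Fin m) k)) p :=
    expChar_of_injective_algebraMap (FaithfulSMul.algebraMap_injective k _) p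
  refine ⟨fun j i => (shiftCoeff j (a i)).coeff (p ^ s), fun j => (shiftParam j g).coeff (p ^ s),
    fun j => ?_, fun γ hγ j => ⟨(shiftCoeff j γ).coeff (p ^ s), by
      simp only [hγ, shiftParam_C, Polynomial.coeff_map]⟩⟩
  have h1 := congrArg (fun F => (shiftParam j F).coeff (p ^ s)) hag
  simp only [map_sum, map_mul, map_pow, shiftParam_map_C, shiftParam_C,
    shiftParam_monicForm, Polynomial.finsetSum_coeff, Polynomial.coeff_mul_C,
    Polynomial.coeff_map] at h1
  rw [coeff_linear_pow_mul, coeff_zero_shiftParam] at h1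
  have heq : p ^ s * e' = p ^ s * (e' - 1) + p ^ s := by
    rw [← Nat.mul_succ]
    congr 1
    omega
  rw [h1, heq, pow_add]
  ring

/-- Cramer's rule: if `w_l = ∑ b_{l i} v_i` with a square nonsingular matrix `b`, then a nonzero
multiple of every `v_i` is a combination of the `w_l`. -/
lemma exists_C_mul_eq_sum_of_linearIndependent {A σ : Type*} [CommRing A] [IsDomain A] {N : ℕ}
    {b : Fin N → Fin N → A} (hb : LinearIndependent A b) {v w : Fin N → MvPolynomial σ A}
    (hw : ∀ l, ∑ i, C (b l i) * v i = w l) :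
    ∃ δ : A, δ ≠ 0 ∧ ∃ b' : Fin N → Fin N → A, ∀ i, C δ * v i = ∑ l, C (b' i l) * w l := by
  set M : Matrix (Fin N) (Fin N) A := Matrix.of b with hM
  have hdet : M.det ≠ 0 := by
    intro h0
    obtain ⟨lam, hlam0, hlam⟩ := Matrix.exists_vecMul_eq_zero_iff.2 h0
    refine hlam0 (funext (Fintype.linearIndependent_iff.1 hb lam ?_))
    rw [← hlam, Matrix.vecMul_eq_sum]
    rfl
  refine ⟨M.det, hdet, M.adjugate, fun i => ?_⟩
  calc C M.det * v i
      = ∑ i', C ((M.adjugate * M) i i') * v i' := by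
        rw [Matrix.adjugate_mul, Finset.sum_eq_single i]
        · simp
        · intro b _ hb
          simp [Matrix.one_apply_ne hb.symm]
        · simp
    _ = ∑ l, C (M.adjugate i l) * ∑ i', C (b l i') * v i' := by
        simp only [Matrix.mul_apply, map_sum, map_mul, Finset.sum_mul, Finset.mul_sum, mul_assoc]
        rw [Finset.sum_comm]
        rfl
    _ = _ := by simp only [hw]

/-- If `z ^ e g`, with `z` the generic linear form and `z ∤ g`, is a combination of the `v i` over
`k[t]`, then there are at least as many `v i` as variables, and, in case of equality and if the
`v i` have generically no common factor on hyperplanes, all `D`-th powers of variables are in the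
`k`-span of the `v i`, where `D` is their degree, which moreover is a power of the characteristic
exponent. -/
lemma pow_mem_span_of_pow_mul_eq_sum [Infinite k] (p : ℕ) [ExpChar k p] {D : ℕ}
    {v : Fin n → MvPolynomial (Fin (m + 1)) k} (hv : ∀ i, (v i).IsHomogeneous D)
    (hcop : Generic fun c : Fin m → k => ∀ Y, (∀ i, Y ∣ restrictHyp c (v i)) → IsUnit Y)
    {a : Fin n → MvPolynomial (Fin m) k} {e : ℕ} (he : e ≠ 0)
    {g : MvPolynomial (Fin (m + 1)) (MvPolynomial (Fin m) k)}
    (hag : ∑ i, C (a i) * map C (v i) = monicForm X ^ e * g) (hg : ¬ monicForm X ∣ g) :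
    m + 1 ≤ n ∧ (n = m + 1 → ∃ s, D = p ^ s ∧
      ∀ i, (X i : MvPolynomial (Fin (m + 1)) k) ^ D ∈ Submodule.span k (Set.range v)) := by
  obtain ⟨s, e', hee, he'⟩ := exists_eq_expChar_pow_mul k p he
  have he'0 : e' ≠ 0 := by rintro rfl; simp at he'
  rw [hee] at hag
  obtain ⟨b, g', hb, hg'⟩ := exists_shifted_relations p he'0 hag
  set q := p ^ s with hqdef
  have hq : q ≠ 0 := (pow_pos (expChar_pos k p) s).ne'
  have heq : q * e' = q * (e' - 1) + q := by
    rw [← Nat.mul_succ]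
    congr 1
    omega
  have hg0 : g ≠ 0 := by rintro rfl; simp at hg
  -- the relations `∑ cf l i • v i = z ^ (e - q) * h l`
  obtain ⟨z, hz⟩ : ∃ z : MvPolynomial (Fin (m + 1)) (MvPolynomial (Fin m) k), z = monicForm X :=
    ⟨_, rfl⟩
  let h : Fin (m + 1) → MvPolynomial (Fin (m + 1)) (MvPolynomial (Fin m) k) :=
    Fin.snoc (fun j => (e' : MvPolynomial (Fin (m + 1)) (MvPolynomial (Fin m) k)) *
      X j.castSucc ^ q * g + monicForm X ^ q * g' j) (monicForm X ^ q * g)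
  have hhj : ∀ j : Fin m, h j.castSucc =
      (e' : MvPolynomial (Fin (m + 1)) (MvPolynomial (Fin m) k)) *
        X j.castSucc ^ q * g + monicForm X ^ q * g' j := fun j => by simp only [h, Fin.snoc_castSucc]
  have hhl : h (Fin.last m) = monicForm X ^ q * g := by simp only [h, Fin.snoc_last]
  let cf : Fin (m + 1) → Fin n → MvPolynomial (Fin m) k := Fin.snoc b a
  have hcf : ∀ l, ∑ i, C (cf l i) * map C (v i) = z ^ (q * (e' - 1)) * h l := by
    intro l
    refine Fin.lastCases ?_ (fun j => ?_) l
    · rw [hhl, ← mul_assoc, hz, ← pow_add, ← heq, ← hag]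
      simp only [cf, Fin.snoc_last]
    · rw [hhj, hz, ← hb j]
      simp only [cf, Fin.snoc_castSucc]
  clear_value h cf
  have he'A : ¬ monicForm X ∣ (e' : MvPolynomial (Fin (m + 1)) (MvPolynomial (Fin m) k)) := by
    rw [monicForm_dvd_iff, map_natCast, ← map_natCast C, ← map_natCast C, C_eq_zero, C_eq_zero]
    exact he'
  have hcfli : LinearIndependent (MvPolynomial (Fin m) k) cf := by
    rw [Fintype.linearIndependent_iff]
    intro lam hlam
    have hlam' : ∀ i, ∑ l, lam l * cf l i = 0 := fun i => by simpa using congrFun hlam i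
    have h1 : z ^ (q * (e' - 1)) * ∑ l, C (lam l) * h l = 0 := by
      calc z ^ (q * (e' - 1)) * ∑ l, C (lam l) * h l
          = ∑ l, C (lam l) * (z ^ (q * (e' - 1)) * h l) := by
            rw [Finset.mul_sum]
            exact Finset.sum_congr rfl fun l _ => by ring
        _ = ∑ i, C (∑ l, lam l * cf l i) * map C (v i) := by
            simp only [← hcf, Finset.mul_sum, map_sum, map_mul, Finset.sum_mul, mul_assoc]
            exact Finset.sum_comm
        _ = 0 := by simp only [hlam', map_zero, zero_mul, Finset.sum_const_zero]
    have h2 := (mul_eq_zero.1 h1).resolve_left (pow_ne_zero _ (hz ▸ monicForm_ne_zero _))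
    rw [Fin.sum_univ_castSucc] at h2
    simp only [hhj, hhl] at h2
    obtain ⟨h3, h4⟩ := eq_zero_of_sum_mul_eq_zero hg hq he'A h2
    exact fun l => Fin.lastCases h4 h3 l
  refine ⟨by simpa using hcfli.fintype_card_le_finrank, ?_⟩
  rintro rfl
  obtain ⟨δ, hδ, b', hadj⟩ := exists_C_mul_eq_sum_of_linearIndependent hcfli hcf
  obtain ⟨c, hc, hcδ⟩ := (hcop.and (Generic.eval_ne_zero hδ)).exists_point
  have hadjc : ∀ i, C (eval c δ) * restrictHyp c (v i) =
      ∑ l, C (eval c (b' i l)) *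
        ((0 : MvPolynomial (Fin m) k) ^ (q * (e' - 1)) * restrictHyp c (map (eval c) (h l))) := by
    intro i
    have := congrArg (fun F => restrictHyp c (map (eval c) F)) (hadj i)
    simpa only [map_mul, map_sum, map_pow, map_C, map_eval_map_C, hz, map_eval_monicForm,
      restrictHyp_C, restrictHyp_monicForm] using this
  have hunit : IsUnit (C (eval c δ) : MvPolynomial (Fin m) k) :=
    (isUnit_iff_ne_zero.2 hcδ).map C
  -- otherwise all `v i` would vanish on the hyperplane
  have he'1 : e' = 1 := by
    by_contra hne
    have h0 : q * (e' - 1) ≠ 0 := mul_ne_zero hq (by omega)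
    refine not_isUnit_zero (hc 0 fun i => ?_)
    have := hadjc i
    simp only [zero_pow h0, zero_mul, mul_zero, Finset.sum_const_zero] at this
    rw [(mul_eq_zero.1 this).resolve_left hunit.ne_zero]
  -- the restriction of `g` is a common factor, so `g` is constant
  have hgunit : IsUnit (restrictHyp c (map (eval c) g)) := by
    refine hc _ fun i => ?_
    rw [← hunit.dvd_mul_left, hadjc]
    refine Finset.dvd_sum fun l _ => Dvd.dvd.mul_left (Dvd.dvd.mul_left ?_ _) _
    refine Fin.lastCases ?_ (fun j => ?_) l
    · rw [hhl, map_mul, map_mul]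
      exact dvd_mul_left _ _
    · simp only [hhj, map_mul, map_add, map_pow, map_eval_monicForm,
        restrictHyp_monicForm, zero_pow hq, zero_mul, add_zero]
      exact dvd_mul_left _ _
  have hw : (monicForm X ^ (q * e') * g).IsHomogeneous D := by
    rw [← hag]
    refine IsHomogeneous.sum _ _ _ fun i _ => ?_
    simpa using ((hv i).map C).C_mul (a i)
  obtain ⟨b, hb, hgb⟩ := ((isHomogeneous_monicForm _).pow (q * e')).of_mul_left hw
    (pow_ne_zero _ (monicForm_ne_zero _)) hg0
  have hb0 : b = 0 := ((hgb.map (eval c)).restrictHyp c).eq_zero_of_isUnit hgunit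
  have hDq : D = q := by rw [hb, hb0, he'1]; simp
  subst hb0
  obtain ⟨γ, hγ⟩ : ∃ γ, g = C γ := ⟨_, (totalDegree_eq_zero_iff_eq_C.1
    (Nat.le_zero.1 hgb.totalDegree_le))⟩
  have hγ0 : γ ≠ 0 := by rintro rfl; simp at hγ; exact hg0 hγ
  refine ⟨s, hDq, ?_⟩
  rw [hDq]
  obtain ⟨c, hc⟩ := (Generic.eval_ne_zero hγ0).exists_point
  have hspan : ∀ l, map (eval c) (h l) ∈ Submodule.span k (Set.range v) := by
    intro l
    have := congrArg (map (eval c)) (hcf l)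
    rw [he'1] at this
    simp only [Nat.sub_self, mul_zero, pow_zero, one_mul, map_sum, map_mul, map_C,
      map_eval_map_C] at this
    rw [← this]
    refine Submodule.sum_mem _ fun i _ => ?_
    rw [C_mul']
    exact Submodule.smul_mem _ _ (Submodule.subset_span ⟨i, rfl⟩)
  have hzq : monicForm c ^ q ∈ Submodule.span k (Set.range v) := by
    have h1 := hspan (Fin.last m)
    simp only [hhl, hγ, map_mul, map_pow, map_eval_monicForm, map_C] at h1
    rw [mul_comm, C_mul', Submodule.smul_mem_iff _ hc] at h1
    exact h1
  have hX : ∀ j : Fin m, (X j.castSucc : MvPolynomial (Fin (m + 1)) k) ^ q ∈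
      Submodule.span k (Set.range v) := by
    intro j
    have h1 := hspan j.castSucc
    obtain ⟨κ, hκ⟩ := hg' γ hγ j
    simp only [hhj, hκ, hγ, map_mul, map_add, map_pow, map_eval_monicForm,
      map_C, map_X, he'1, Nat.cast_one, one_mul] at h1
    rw [mul_comm, C_mul', mul_comm (_ ^ _), C_mul'] at h1
    rwa [Submodule.add_mem_iff_left _ (Submodule.smul_mem _ _ hzq),
      Submodule.smul_mem_iff _ hc] at h1
  intro i
  refine Fin.lastCases ?_ hX i
  have : ExpChar (MvPolynomial (Fin (m + 1)) k) p :=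
    expChar_of_injective_algebraMap (FaithfulSMul.algebraMap_injective k _) p
  rw [monicForm, hqdef, add_pow_expChar_pow, sum_pow_expChar_pow] at hzq
  rw [← Submodule.add_mem_iff_left _ (Submodule.sum_mem _ fun j _ => ?_)]
  · exact hzq
  · rw [mul_pow, ← C_pow, C_mul']
    exact Submodule.smul_mem _ _ (hX j)

/-- Restriction of a linear system of forms to a generic hyperplane preserves its dimension `n`, if
`n` is at most the number of variables and the generic restriction has no common factor, unless the
system contains the `D`-th powers of all the variables and their degree `D` is a power of the
characteristic exponent. -/
theorem generic_linearIndependent_restrictHyp [Infinite k] {D : ℕ} (hn : n ≤ m + 1)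
    {v : Fin n → MvPolynomial (Fin (m + 1)) k} (hv : ∀ i, (v i).IsHomogeneous D)
    (hli : LinearIndependent k v)
    (hcop : Generic fun c : Fin m → k => ∀ Y, (∀ i, Y ∣ restrictHyp c (v i)) → IsUnit Y)
    (hpow : n = m + 1 → ∀ (p : ℕ) [ExpChar k p] (s : ℕ), D = p ^ s →
      ∃ i, (X i : MvPolynomial (Fin (m + 1)) k) ^ D ∉ Submodule.span k (Set.range v)) :
    Generic fun c : Fin m → k => LinearIndependent k fun i => restrictHyp c (v i) := by
  -- specialise from the hyperplane with indeterminate coefficients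
  by_cases hA : LinearIndependent (MvPolynomial (Fin m) k)
      fun i => restrictHyp X (map C (v i) : MvPolynomial _ (MvPolynomial (Fin m) k))
  · refine (generic_linearIndependent_map hA).mono fun c hc => ?_
    simpa only [map_eval_restrictHyp, map_eval_map_C] using hc
  exfalso
  obtain ⟨a, hsum, i, hai⟩ := Fintype.not_linearIndependent_iff.1 hA
  have ha : a ≠ 0 := fun h => hai (by simp [h])
  set w : MvPolynomial (Fin (m + 1)) (MvPolynomial (Fin m) k) :=
    ∑ i, C (a i) * map C (v i) with hw
  have hw0 : w ≠ 0 := fun h => ha (sum_C_mul_map_C_eq_zero hli h)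
  have hzw : monicForm X ∣ w := by
    rw [monicForm_dvd_iff, hw, map_sum, ← hsum]
    refine Finset.sum_congr rfl fun i _ => ?_
    rw [map_mul, restrictHyp_C, C_mul']
  obtain ⟨g, hwg, hg⟩ := (FiniteMultiplicity.of_prime_left (prime_monicForm X)
    hw0).exists_eq_pow_mul_and_not_dvd
  obtain ⟨p, hp⟩ := ExpChar.exists k
  obtain ⟨h1, h2⟩ := pow_mem_span_of_pow_mul_eq_sum p hv hcop (by
    intro h0
    rw [h0, pow_zero, one_mul] at hwg
    exact hg (hwg ▸ hzw)) hwg hg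
  have hnm : n = m + 1 := le_antisymm hn h1
  obtain ⟨s, hs, h3⟩ := h2 hnm
  obtain ⟨i, hi⟩ := hpow hnm p s hs
  exact hi (h3 i)

end Core

/-! ### Generic restriction of linear systems -/

section Subspaces

variable {k E : Type*} [Field k] [AddCommGroup E] [Module k E]

/-- Subspaces of every intermediate dimension exist between two subspaces. -/
lemma Submodule.exists_le_le_finrank_eq {U V : Submodule k E} [FiniteDimensional k V]
    (hUV : U ≤ V) {n : ℕ} (hU : finrank k U ≤ n) (hn : n ≤ finrank k V) :
    ∃ W, U ≤ W ∧ W ≤ V ∧ finrank k W = n := by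
  induction n, hU using Nat.le_induction with
  | base => exact ⟨U, le_rfl, hUV, rfl⟩
  | succ n _ ih =>
    obtain ⟨W, hUW, hWV, hW⟩ := ih (by omega)
    obtain ⟨x, hxV, hxW⟩ := SetLike.exists_of_lt (lt_of_le_of_ne hWV (by
      rintro rfl; omega))
    have : FiniteDimensional k W := Submodule.finiteDimensional_of_le hWV
    refine ⟨W ⊔ span k {x}, hUW.trans le_sup_left,
      sup_le hWV ((span_singleton_le_iff_mem _ _).2 hxV), ?_⟩
    have h1 := Submodule.finrank_sup_add_finrank_inf_eq W (span k {x})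
    have h2 : W ⊓ span k {x} = ⊥ := by
      rw [← disjoint_iff]
      exact (disjoint_span_singleton' (by rintro rfl; exact hxW W.zero_mem)).2 hxW
    rw [h2, finrank_bot, finrank_span_singleton (by rintro rfl; exact hxW W.zero_mem), hW] at h1
    exact h1

lemma Submodule.exists_le_notMem_finrank_le {U V : Submodule k E} [FiniteDimensional k V]
    (hUV : U ≤ V) {y : E} (hy : y ∉ U) :
    ∃ W, U ≤ W ∧ W ≤ V ∧ y ∉ W ∧ finrank k V ≤ finrank k W + 1 := by
  obtain ⟨f, hfy, hUf⟩ := U.exists_le_ker_of_notMem hy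
  refine ⟨(LinearMap.ker (f.domRestrict V)).map V.subtype, fun x hx => ?_, map_subtype_le _ _,
    ?_, ?_⟩
  · exact ⟨⟨x, hUV hx⟩, hUf hx, rfl⟩
  · rintro ⟨x, hx, rfl⟩
    exact hfy hx
  · rw [finrank_map_subtype_eq, ← LinearMap.finrank_range_add_finrank_ker (f.domRestrict V),
      add_comm]
    gcongr
    exact (Submodule.finrank_le _).trans (by simp)

end Subspaces

/-- The pure powers `X_0 ^ D, X_1 ^ D, X_2 ^ D` are linearly independent, so they are not all in a
plane. -/
lemma exists_X_pow_notMem {k : Type*} [Field k] {N D : ℕ} (hN : 3 ≤ N) (hD : D ≠ 0)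
    {U : Submodule k (MvPolynomial (Fin N) k)} [FiniteDimensional k U] (hU : finrank k U ≤ 2) :
    ∃ i, (X i : MvPolynomial (Fin N) k) ^ D ∉ U := by
  by_contra! h
  have hli : LinearIndependent k fun i : Fin N => (⟨X i ^ D, h i⟩ : U) := by
    rw [Fintype.linearIndependent_iff]
    intro a ha i
    have h1 := congrArg (fun x : U => eval (Pi.single i 1) (x : MvPolynomial (Fin N) k)) ha
    simpa [smul_eval, Pi.single_apply, ite_pow, zero_pow hD] using h1
  have := hli.fintype_card_le_finrank
  rw [Fintype.card_fin] at this
  omega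

/-- A linear system `V` of forms of degree `D` in `m + 1 ≥ 3` variables without a common factor
contains an `n`-dimensional subsystem that restricts isomorphically to the generic hyperplane, and
its generic restriction has no common factor. -/
theorem generic_restrictHyp_linearSystem {k : Type*} [Field k] [Infinite k] {m n D : ℕ}
    (hm : 2 ≤ m) (hn : 2 ≤ n) {V : Submodule k (MvPolynomial (Fin (m + 1)) k)}
    (hV : ∀ F ∈ V, F.IsHomogeneous D) (hdim : n ≤ finrank k V)
    (hdvd : ∀ e ≠ 0, ∀ Y : MvPolynomial (Fin (m + 1)) k, Y.IsHomogeneous e → ∃ F ∈ V, ¬ Y ∣ F)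
    (hcases : n ≤ m ∨ (n = m + 1 ∧ n < finrank k V) ∨
      (n = m + 1 ∧ ∃ r : Fin (m + 1) → k, (∑ i, C (r i) * X i) ^ D ∉ V)) :
    Generic fun c : Fin m → k => (∀ Y, (∀ F ∈ V, Y ∣ restrictHyp c F) → IsUnit Y) ∧
      ∃ v : Fin n → MvPolynomial (Fin (m + 1)) k, (∀ i, v i ∈ V) ∧
        LinearIndependent k fun i => restrictHyp c (v i) := by
  have : FiniteDimensional k V := Module.finite_of_finrank_pos (by omega)
  obtain ⟨u, hu, w, hw, hu0, huw⟩ := exists_isRelPrime_of_forall_not_dvd hV (by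
    rintro rfl; simp at hdim; omega) hdvd
  set U : Submodule k (MvPolynomial (Fin (m + 1)) k) := Submodule.span k {u, w}
  have hUV : U ≤ V := Submodule.span_le.2 (Set.pair_subset hu hw)
  have hUfin : FiniteDimensional k U := Submodule.finiteDimensional_of_le hUV
  have hUdim : finrank k U ≤ 2 := by
    classical
    have := finrank_span_finset_le_card (R := k) ({u, w} : Finset (MvPolynomial (Fin (m + 1)) k))
    rw [Finset.coe_pair] at this
    exact this.trans Finset.card_le_two
  -- an `n`-dimensional subsystem that contains `u` and `w` but not all the `D`-th powers of
  -- variables, in case `D` is a power of the characteristic exponent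
  obtain ⟨W, hUW, hWV, hWdim, hpow⟩ : ∃ W, U ≤ W ∧ W ≤ V ∧ finrank k W = n ∧
      (n = m + 1 → ∀ (p : ℕ) [ExpChar k p] (s : ℕ), D = p ^ s →
        ∃ i, (X i : MvPolynomial (Fin (m + 1)) k) ^ D ∉ W) := by
    rcases hcases with h | ⟨-, h⟩ | ⟨-, r, hr⟩
    · obtain ⟨W, h1, h2, h3⟩ := Submodule.exists_le_le_finrank_eq hUV (hUdim.trans hn) hdim
      exact ⟨W, h1, h2, h3, fun h' => by omega⟩
    · rcases eq_or_ne D 0 with rfl | hD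
      · obtain ⟨W, h1, h2, h3⟩ := Submodule.exists_le_le_finrank_eq hUV (hUdim.trans hn) hdim
        refine ⟨W, h1, h2, h3, fun _ p _ s hs => ?_⟩
        exact absurd hs.symm (pow_pos (expChar_pos k p) s).ne'
      · obtain ⟨i, hi⟩ := exists_X_pow_notMem (by omega) hD hUdim
        obtain ⟨V', h1, h2, h3, h4⟩ := Submodule.exists_le_notMem_finrank_le hUV hi
        have : FiniteDimensional k V' := Submodule.finiteDimensional_of_le h2
        obtain ⟨W, h5, h6, h7⟩ := Submodule.exists_le_le_finrank_eq h1 (hUdim.trans hn)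
          (by omega)
        exact ⟨W, h5, h6.trans h2, h7, fun _ _ _ _ _ => ⟨i, fun h => h3 (h6 h)⟩⟩
    · obtain ⟨W, h1, h2, h3⟩ := Submodule.exists_le_le_finrank_eq hUV (hUdim.trans hn) hdim
      refine ⟨W, h1, h2, h3, fun _ p _ s hs => ?_⟩
      by_contra! hX
      have : ExpChar (MvPolynomial (Fin (m + 1)) k) p :=
        expChar_of_injective_algebraMap (FaithfulSMul.algebraMap_injective k _) p
      apply hr
      rw [hs, sum_pow_expChar_pow]
      refine Submodule.sum_mem _ fun i _ => ?_
      rw [mul_pow, ← C_pow, C_mul', ← hs]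
      exact V.smul_mem _ (h2 (hX i))
  have : FiniteDimensional k W := Submodule.finiteDimensional_of_le hWV
  let b := finBasisOfFinrankEq k W hWdim
  let v : Fin n → MvPolynomial (Fin (m + 1)) k := fun i => b i
  have hspan : Submodule.span k (Set.range v) = W := by
    have : Set.range v = W.subtype '' Set.range b := by rw [← Set.range_comp]; rfl
    rw [this, ← Submodule.map_span, b.span_eq, Submodule.map_top, Submodule.range_subtype]
  have hvW : ∀ i, v i ∈ W := fun i => (b i).2
  have hli : LinearIndependent k v := b.linearIndependent.map' W.subtype W.ker_subtype
  have hgen := generic_isRelPrime_restrictHyp hm hu0 huw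
  have hgcd : Generic fun c : Fin m → k =>
      ∀ Y, (∀ i, Y ∣ restrictHyp c (v i)) → IsUnit Y := by
    refine hgen.mono fun c hc Y hY => ?_
    have hYW : W ≤ ((Ideal.span {Y}).restrictScalars k).comap (restrictHyp c).toLinearMap := by
      rw [← hspan, Submodule.span_le]
      rintro _ ⟨i, rfl⟩
      simpa [Ideal.mem_span_singleton] using hY i
    have hYW' : ∀ F ∈ W, Y ∣ restrictHyp c F := fun F hF => by
      simpa [Ideal.mem_span_singleton] using hYW hF
    exact hc (hYW' u (hUW (Submodule.subset_span (by simp))))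
      (hYW' w (hUW (Submodule.subset_span (by simp))))
  refine (hgen.and (generic_linearIndependent_restrictHyp (by omega) (fun i => hV _ (hWV (hvW i)))
    hli hgcd (by rwa [hspan]))).mono fun c hc => ⟨fun Y hY => ?_, v, fun i => hWV (hvW i), hc.2⟩
  exact hc.1 (hY u hu) (hY w hw)

/-! ### Representing elements of a ring by forms -/

section InitialForms

variable {R k : Type*} [CommRing R] [Field k] {N : ℕ}

/-- Let `x` generate the kernel `𝔪` of `ρ : R → k`. The form `F` of degree `i` over `k` represents
`r` if some lift of `F` to a form of degree `i` over `R` takes at `x` the value `r` modulo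
`𝔪 ^ (i + 1)`; thus the class of `r` in `𝔪 ^ i / 𝔪 ^ (i + 1)` is `F` evaluated at the classes of
`x`. -/
def Represents (ρ : R →+* k) (x : Fin N → R) (i : ℕ) (F : MvPolynomial (Fin N) k) (r : R) : Prop :=
  ∃ G : MvPolynomial (Fin N) R, G.IsHomogeneous i ∧ map ρ G = F ∧
    r - eval x G ∈ RingHom.ker ρ ^ (i + 1)

lemma MvPolynomial.IsHomogeneous.eval_const_mul {G : MvPolynomial (Fin N) R} {i : ℕ}
    (hG : G.IsHomogeneous i) (a : R) (c : Fin N → R) :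
    eval (fun j => a * c j) G = a ^ i * eval c G := by
  rw [eval_eq', eval_eq', Finset.mul_sum]
  refine Finset.sum_congr rfl fun d hd => ?_
  simp only [mul_pow, Finset.prod_mul_distrib, Finset.prod_pow_eq_pow_sum]
  have hdeg : Finsupp.degree d = i := by rw [hG.degree_eq_sum_deg_support hd, Finsupp.degree_apply]
  rw [← Finsupp.degree_eq_sum, hdeg]
  ring

variable {ρ : R →+* k} {x : Fin N → R}

lemma exists_isHomogeneous_map_eq (hρ : Function.Surjective ρ) {F : MvPolynomial (Fin N) k} {i : ℕ}
    (hF : F.IsHomogeneous i) : ∃ G : MvPolynomial (Fin N) R, G.IsHomogeneous i ∧ map ρ G = F := by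
  choose f hf using hρ
  refine ⟨∑ d ∈ F.support, monomial d (f (coeff d F)), IsHomogeneous.sum _ _ _ fun d hd => ?_, ?_⟩
  · refine isHomogeneous_monomial _ ?_
    rw [hF.degree_eq_sum_deg_support hd, Finsupp.degree_apply]
  · simp only [map_sum, map_monomial, hf]
    exact F.as_sum.symm

namespace Represents

variable {i j : ℕ} {F F' : MvPolynomial (Fin N) k} {r r' : R}

lemma isHomogeneous (h : Represents ρ x i F r) : F.IsHomogeneous i := by
  obtain ⟨G, hG, rfl, -⟩ := h
  exact hG.map ρ

lemma add (h : Represents ρ x i F r) (h' : Represents ρ x i F' r') :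
    Represents ρ x i (F + F') (r + r') := by
  obtain ⟨G, hG, rfl, hr⟩ := h
  obtain ⟨G', hG', rfl, hr'⟩ := h'
  refine ⟨G + G', hG.add hG', map_add _ _ _, ?_⟩
  rw [map_add, add_sub_add_comm]
  exact add_mem hr hr'

lemma C_mul (h : Represents ρ x i F r) (a : R) : Represents ρ x i (C (ρ a) * F) (a * r) := by
  obtain ⟨G, hG, rfl, hr⟩ := h
  refine ⟨C a * G, hG.C_mul a, by simp, ?_⟩
  rw [map_mul, eval_C, ← mul_sub]
  exact Ideal.mul_mem_left _ _ hr

lemma sub (h : Represents ρ x i F r) (h' : Represents ρ x i F' r') :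
    Represents ρ x i (F - F') (r - r') := by
  have := h.add (h'.C_mul (-1))
  simpa [sub_eq_add_neg] using this

lemma zero : Represents ρ x i 0 0 := ⟨0, isHomogeneous_zero _ _ _, by simp, by simp⟩

lemma sum {ι : Type*} (s : Finset ι) {F : ι → MvPolynomial (Fin N) k} {r : ι → R}
    (h : ∀ l ∈ s, Represents ρ x i (F l) (r l)) :
    Represents ρ x i (∑ l ∈ s, F l) (∑ l ∈ s, r l) := by
  classical
  induction s using Finset.induction_on with
  | empty => simpa using zero
  | insert a s ha ih =>
    rw [Finset.sum_insert ha, Finset.sum_insert ha]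
    exact (h a (by simp)).add (ih fun l hl => h l (by simp [hl]))

lemma congr (h : Represents ρ x i F r) (hr : r' - r ∈ RingHom.ker ρ ^ (i + 1)) :
    Represents ρ x i F r' := by
  obtain ⟨G, hG, hF, hrG⟩ := h
  refine ⟨G, hG, hF, ?_⟩
  rw [← sub_add_sub_cancel]
  exact add_mem hr hrG

variable (hx : Ideal.span (Set.range x) = RingHom.ker ρ)
include hx

lemma mem_pow (h : Represents ρ x i F r) : r ∈ RingHom.ker ρ ^ i := by
  obtain ⟨G, hG, -, hr⟩ := h
  rw [← sub_add_cancel r (eval x G)]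
  refine add_mem (Ideal.pow_le_pow_right (Nat.le_succ i) hr) ?_
  rw [← hx]
  exact (Ideal.mem_span_pow_iff_exists_isHomogeneous x _).2 ⟨G, hG, rfl⟩

lemma mul (h : Represents ρ x i F r) (h' : Represents ρ x j F' r') :
    Represents ρ x (i + j) (F * F') (r * r') := by
  have hr' := h'.mem_pow hx
  obtain ⟨G, hG, rfl, hrG⟩ := h
  have hG0 : eval x G ∈ RingHom.ker ρ ^ i := by
    rw [← hx]
    exact (Ideal.mem_span_pow_iff_exists_isHomogeneous x _).2 ⟨G, hG, rfl⟩
  obtain ⟨G', hG', rfl, hrG'⟩ := h'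
  refine ⟨G * G', hG.mul hG', map_mul _ _ _, ?_⟩
  have : r * r' - eval x (G * G') = (r - eval x G) * r' + eval x G * (r' - eval x G') := by
    rw [map_mul]
    ring
  rw [this]
  refine add_mem ?_ ?_
  · rw [show i + j + 1 = i + 1 + j by omega, pow_add]
    exact Ideal.mul_mem_mul hrG hr'
  · rw [add_assoc, pow_add]
    exact Ideal.mul_mem_mul hG0 hrG'

lemma exists_of_mem_pow (hr : r ∈ RingHom.ker ρ ^ i) : ∃ F, Represents ρ x i F r := by
  rw [← hx, Ideal.mem_span_pow_iff_exists_isHomogeneous] at hr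
  obtain ⟨G, hG, rfl⟩ := hr
  exact ⟨map ρ G, G, hG, rfl, by simp⟩

lemma exists_of_isHomogeneous (hρ : Function.Surjective ρ) (hF : F.IsHomogeneous i) :
    ∃ r ∈ RingHom.ker ρ ^ i, Represents ρ x i F r := by
  obtain ⟨G, hG, hGF⟩ := exists_isHomogeneous_map_eq hρ hF
  have : Represents ρ x i F (eval x G) := ⟨G, hG, hGF, by simp⟩
  exact ⟨_, this.mem_pow hx, this⟩

lemma mem_pow_succ (h : Represents ρ x i 0 r) : r ∈ RingHom.ker ρ ^ (i + 1) := by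
  obtain ⟨G, hG, hG0, hr⟩ := h
  rw [← sub_add_cancel r (eval x G)]
  refine add_mem hr ?_
  rw [G.as_sum, map_sum]
  refine Ideal.sum_mem _ fun d hd => ?_
  have h1 : coeff d G ∈ RingHom.ker ρ := by
    rw [RingHom.mem_ker, ← coeff_map, hG0, coeff_zero]
  have h2 : eval x (monomial d 1) ∈ RingHom.ker ρ ^ i := by
    rw [← hx]
    refine (Ideal.mem_span_pow_iff_exists_isHomogeneous x _).2 ⟨_, isHomogeneous_monomial _ ?_, rfl⟩
    rw [hG.degree_eq_sum_deg_support hd, Finsupp.degree_apply]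
  rw [← mul_one (coeff d G), ← C_mul_monomial, map_mul, eval_C, pow_succ']
  exact Ideal.mul_mem_mul h1 h2

end Represents

end InitialForms

/-! ### The associated graded ring of a regular local ring -/

lemma ker_eq_maximalIdeal {R k : Type*} [CommRing R] [IsLocalRing R] [Field k] {ρ : R →+* k}
    (hρ : Function.Surjective ρ) : RingHom.ker ρ = IsLocalRing.maximalIdeal R :=
  IsLocalRing.eq_maximalIdeal (RingHom.ker_isMaximal_of_surjective ρ hρ)

lemma sup_span_singleton_pow_le {R : Type*} [CommRing R] (I : Ideal R) (y : R) (i : ℕ) :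
    (I ⊔ Ideal.span {y}) ^ i ≤ I ⊔ Ideal.span {y ^ i} := by
  induction i with
  | zero => simp
  | succ i ih =>
    rw [pow_succ]
    refine (Ideal.mul_mono_left ih).trans ?_
    rw [Ideal.sup_mul, Ideal.mul_sup, Ideal.mul_sup, Ideal.span_singleton_mul_span_singleton,
      ← pow_succ]
    exact sup_le (le_sup_of_le_left (sup_le Ideal.mul_le_left Ideal.mul_le_left))
      (sup_le_sup_right Ideal.mul_le_right _)

/-- In a local ring whose maximal ideal is generated by no more elements than its height, a nonzero
form over the infinite residue field represents no element of `𝔪 ^ (i + 1)`, that is, the associated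
graded ring is a polynomial ring. If it did, pick a point `c` where the form does not vanish; modulo
the ideal `I` of the line through `c` the maximal ideal is generated by one element `y`, and the form
becomes a unit times `y ^ i`. Nakayama's lemma gives `y ^ i ∈ I`, so `𝔪` is minimal over `I`,
contradicting Krull's height theorem. -/
lemma Represents.eq_zero_of_mem_pow_succ {R k : Type*} [CommRing R] [IsLocalRing R]
    [IsNoetherianRing R] [Field k] [Infinite k] {ρ : R →+* k} (hρ : Function.Surjective ρ) {M : ℕ}
    {x : Fin (M + 1) → R} (hx : Ideal.span (Set.range x) = RingHom.ker ρ)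
    (hht : (M + 1 : ℕ) ≤ (RingHom.ker ρ).height) {i : ℕ} {F : MvPolynomial (Fin (M + 1)) k} {r : R}
    (hF : Represents ρ x i F r) (hr : r ∈ RingHom.ker ρ ^ (i + 1)) : F = 0 := by
  obtain ⟨G, hG, rfl, hrG⟩ := hF
  have hGm : eval x G ∈ RingHom.ker ρ ^ (i + 1) := by
    have := sub_mem hr hrG
    rwa [sub_sub_cancel] at this
  by_contra hF
  obtain ⟨c, hc⟩ := (Generic.eval_ne_zero (mul_ne_zero hF (X_ne_zero 0))).exists_point
  rw [map_mul, eval_X] at hc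
  have hFc := left_ne_zero_of_mul hc
  have hc0 := right_ne_zero_of_mul hc
  choose f hf using hρ
  set c' : Fin (M + 1) → R := fun j => f (c j) with hc'
  have hunit : ∀ u : R, ρ u ≠ 0 → IsUnit u := by
    intro u hu
    by_contra h
    have h1 : u ∈ IsLocalRing.maximalIdeal R := (IsLocalRing.mem_maximalIdeal u).2 h
    rw [← ker_eq_maximalIdeal (ρ := ρ) (fun b => ⟨f b, hf b⟩)] at h1
    exact hu h1
  set I : Ideal R := Ideal.span (Set.range fun j : Fin M => c' 0 * x j.succ - c' j.succ * x 0)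
    with hI
  have hker : (RingHom.ker ρ).IsMaximal :=
    RingHom.ker_isMaximal_of_surjective ρ fun b => ⟨f b, hf b⟩
  have hIm : I ≤ RingHom.ker ρ := by
    rw [hI, Ideal.span_le]
    rintro _ ⟨j, rfl⟩
    have hxm : ∀ j, x j ∈ RingHom.ker ρ := fun j => hx ▸ Ideal.subset_span ⟨j, rfl⟩
    exact sub_mem (Ideal.mul_mem_left _ _ (hxm _)) (Ideal.mul_mem_left _ _ (hxm _))
  have hc0u : IsUnit (c' 0) := hunit _ (by simpa [hc', hf] using hc0)
  -- modulo `I` the point `c' 0 • x` is `x 0 • c'`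
  have hcx : ∀ j, c' 0 * x j - x 0 * c' j ∈ I := by
    intro j
    refine Fin.cases ?_ (fun j => ?_) j
    · rw [mul_comm, sub_self]
      exact I.zero_mem
    · rw [mul_comm (x 0)]
      exact Ideal.subset_span ⟨j, rfl⟩
  have hle : RingHom.ker ρ ≤ I ⊔ Ideal.span {x 0} := by
    rw [← hx, Ideal.span_le]
    rintro _ ⟨j, rfl⟩
    rw [SetLike.mem_coe, ← Ideal.unit_mul_mem_iff_mem _ hc0u,
      ← sub_add_cancel (c' 0 * x j) (x 0 * c' j)]
    exact add_mem (Ideal.mem_sup_left (hcx j))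
      (Ideal.mem_sup_right (Ideal.mul_mem_right _ _ (Ideal.mem_span_singleton_self _)))
  have hGI : c' 0 ^ i * eval x G - x 0 ^ i * eval c' G ∈ I := by
    rw [← hG.eval_const_mul, ← hG.eval_const_mul, ← Ideal.Quotient.eq, map_eval, map_eval]
    congr 2
    ext j
    exact Ideal.Quotient.eq.2 (hcx j)
  have hGc : IsUnit (eval c' G) := by
    refine hunit _ ?_
    rw [map_eval]
    convert hFc
    ext j
    exact hf _
  have hxi : x 0 ^ i ∈ I := by
    have h1 : eval x G ∈ I ⊔ Ideal.span {x 0 ^ (i + 1)} :=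
      sup_span_singleton_pow_le I (x 0) (i + 1) (Ideal.pow_right_mono hle _ hGm)
    have h2 : x 0 ^ i * eval c' G ∈ I ⊔ Ideal.span {x 0 ^ (i + 1)} := by
      rw [← sub_sub_self (c' 0 ^ i * eval x G) (x 0 ^ i * eval c' G)]
      exact sub_mem (Ideal.mul_mem_left _ _ h1) (Ideal.mem_sup_left hGI)
    obtain ⟨b, hb, y, hy, hby⟩ := Submodule.mem_sup.1 h2
    obtain ⟨a, rfl⟩ := Ideal.mem_span_singleton'.1 hy
    have hu : IsUnit (eval c' G - a * x 0) := by
      refine hunit _ fun h0 => ?_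
      have hx0 : ρ (x 0) = 0 := (hx ▸ Ideal.subset_span ⟨0, rfl⟩ : x 0 ∈ RingHom.ker ρ)
      rw [map_sub, map_mul, hx0, mul_zero, sub_zero] at h0
      exact (hGc.map ρ).ne_zero h0
    rw [← Ideal.mul_unit_mem_iff_mem _ hu]
    convert hb using 1
    linear_combination -hby
  have hmin : RingHom.ker ρ ∈ I.minimalPrimes := by
    refine ⟨⟨hker.isPrime, hIm⟩, fun P hP _ => hle.trans (sup_le hP.2 ?_)⟩
    rw [Ideal.span_singleton_le_iff_mem]
    exact hP.1.mem_of_pow_mem i (hP.2 hxi)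
  have h1 := Ideal.height_le_card_of_mem_minimalPrimes_span (Set.finite_range _) hmin
  have h2 : (Set.range fun j : Fin M => c' 0 * x j.succ - c' j.succ * x 0).ncard ≤ M := by
    rw [← Set.image_univ]
    refine (Set.ncard_image_le Set.finite_univ).trans ?_
    simp [Set.ncard_univ]
  have h3 : ((M + 1 : ℕ) : ℕ∞) ≤ (M : ℕ) := hht.trans (h1.trans (by exact_mod_cast h2))
  have h4 : M + 1 ≤ M := by exact_mod_cast h3
  omega

/-! ### Initial forms, numbers of generators and hyperplane sections -/

section InitialFormsOfIdeals

variable {R k : Type*} [CommRing R] [Field k] {N : ℕ} {ρ : R →+* k}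

/-- The space of forms of degree `i` that represent elements of the ideal `I`. -/
def initialForms (hρ : Function.Surjective ρ) (x : Fin N → R) (I : Ideal R) (i : ℕ) :
    Submodule k (MvPolynomial (Fin N) k) where
  carrier := {F | ∃ r ∈ I, Represents ρ x i F r}
  add_mem' := by
    rintro F F' ⟨r, hr, h⟩ ⟨r', hr', h'⟩
    exact ⟨r + r', add_mem hr hr', h.add h'⟩
  zero_mem' := ⟨0, I.zero_mem, Represents.zero⟩
  smul_mem' := by
    rintro c F ⟨r, hr, h⟩
    obtain ⟨a, rfl⟩ := hρ c
    refine ⟨a * r, I.mul_mem_left a hr, ?_⟩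
    rw [← C_mul']
    exact h.C_mul a

variable {hρ : Function.Surjective ρ} {x : Fin N → R} {I : Ideal R} {i : ℕ}

lemma mem_initialForms {F : MvPolynomial (Fin N) k} :
    F ∈ initialForms hρ x I i ↔ ∃ r ∈ I, Represents ρ x i F r := Iff.rfl

lemma isHomogeneous_of_mem_initialForms {F : MvPolynomial (Fin N) k}
    (hF : F ∈ initialForms hρ x I i) : F.IsHomogeneous i := by
  obtain ⟨r, -, h⟩ := hF
  exact h.isHomogeneous

instance : FiniteDimensional k (initialForms hρ x I i) := by
  have : FiniteDimensional k (homogeneousSubmodule (Fin N) k i) :=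
    Module.Finite.iff_fg.2 (homogeneousSubmodule_fg _ _ i)
  exact Submodule.finiteDimensional_of_le (S₂ := homogeneousSubmodule (Fin N) k i)
    fun F hF => isHomogeneous_of_mem_initialForms hF

/-- The initial forms of degree `D` of an ideal `J ⊆ 𝔪 ^ D` span `(J + 𝔪 ^ (D + 1)) / 𝔪 ^ (D + 1)`
over the residue field. -/
lemma muMod_le_finrank_initialForms (hρ : Function.Surjective ρ)
    (hx : Ideal.span (Set.range x) = RingHom.ker ρ) {J : Ideal R} {D : ℕ}
    (hJ : J ≤ RingHom.ker ρ ^ D) :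
    muMod J (RingHom.ker ρ ^ (D + 1)) ≤ finrank k (initialForms hρ x J D) := by
  let b := finBasis k (initialForms hρ x J D)
  choose r hrJ hr using fun l => mem_initialForms.1 (b l).2
  have hle : Submodule.map (Submodule.mkQ (RingHom.ker ρ ^ (D + 1))) (J ⊔ RingHom.ker ρ ^ (D + 1)) =
      Submodule.span R (Set.range fun l => Submodule.mkQ (RingHom.ker ρ ^ (D + 1)) (r l)) := by
    apply le_antisymm
    · rw [Submodule.map_sup, Submodule.mkQ_map_self, sup_bot_eq]
      rintro _ ⟨j, hj, rfl⟩
      obtain ⟨F, hF⟩ := Represents.exists_of_mem_pow hx (hJ hj)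
      have hFV : F ∈ initialForms hρ x J D := ⟨j, hj, hF⟩
      choose f hf using fun b => hρ b
      let a := fun l => f (b.repr ⟨F, hFV⟩ l)
      have hsum : F = ∑ l, C (ρ (a l)) * (b l : MvPolynomial (Fin N) k) := by
        have := congrArg (Submodule.subtype _) (b.sum_repr ⟨F, hFV⟩)
        simp only [map_sum, map_smul, Submodule.subtype_apply] at this
        rw [← this]
        exact Finset.sum_congr rfl fun l _ => by rw [C_mul', hf]
      have h1 := hF.sub (Represents.sum Finset.univ fun l _ => (hr l).C_mul (a l))
      rw [← hsum, sub_self] at h1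
      have h2 := (Submodule.Quotient.eq (RingHom.ker ρ ^ (D + 1))).2 (h1.mem_pow_succ hx)
      rw [Submodule.mkQ_apply, h2, ← Submodule.mkQ_apply, map_sum]
      refine Submodule.sum_mem _ fun l _ => ?_
      rw [← smul_eq_mul, map_smul]
      exact Submodule.smul_mem _ _ (Submodule.subset_span ⟨l, rfl⟩)
    · rw [Submodule.span_le]
      rintro _ ⟨l, rfl⟩
      exact ⟨r l, Ideal.mem_sup_left (hrJ l), rfl⟩
  rw [muMod, hle]
  refine (Submodule.spanFinrank_span_le_ncard_of_finite (Set.finite_range _)).trans ?_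
  rw [← Set.image_univ]
  refine (Set.ncard_image_le Set.finite_univ).trans ?_
  simp [Set.ncard_univ]

/-- Elements of `J` that are linearly independent modulo `K` over the residue field, in the sense
that a combination lies in `K` only if all its coefficients are in the maximal ideal, bound from
below the number of generators of `(J + K) / K`. -/
lemma le_muMod_of_forall_sum_mem [IsNoetherianRing R] (hρ : Function.Surjective ρ) {J K : Ideal R}
    (hJK : ∀ a ∈ RingHom.ker ρ, ∀ j ∈ J, a * j ∈ K) {n : ℕ} {r : Fin n → R} (hr : ∀ l, r l ∈ J)
    (hli : ∀ a : Fin n → R, ∑ l, a l * r l ∈ K → ∀ l, ρ (a l) = 0) : n ≤ muMod J K := by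
  classical
  rw [muMod]
  set W := Submodule.map (Submodule.mkQ K) (J ⊔ K) with hW
  have hfg : W.FG := Submodule.FG.map _ (IsNoetherian.noetherian _)
  by_contra! hlt
  rw [← Submodule.FG.generators_ncard hfg] at hlt
  have hfin := Submodule.FG.finite_generators hfg
  let S := hfin.toFinset
  have hS : (S : Set (R ⧸ K)) = W.generators := hfin.coe_toFinset
  have hcard : S.card < n := by rwa [Set.ncard_eq_toFinset_card _ hfin] at hlt
  have hmem : ∀ l, ∃ α : S → R, Submodule.mkQ K (r l) = ∑ s : S, α s • (s : R ⧸ K) := by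
    intro l
    have h1 : Submodule.mkQ K (r l) ∈ Submodule.span R (S : Set (R ⧸ K)) := by
      rw [hS, Submodule.span_generators]
      exact ⟨r l, Ideal.mem_sup_left (hr l), rfl⟩
    obtain ⟨α, hα⟩ := Submodule.mem_span_finset'.1 h1
    exact ⟨α, hα.symm⟩
  choose α hα using hmem
  -- the maximal ideal kills the generators
  have hkill : ∀ a ∈ RingHom.ker ρ, ∀ s : S, a • (s : R ⧸ K) = 0 := by
    intro a ha s
    have hsW : (s : R ⧸ K) ∈ W := Submodule.FG.generators_mem W (hS ▸ s.2)
    obtain ⟨t, ht, hts⟩ := hsW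
    obtain ⟨j, hj, y, hy, rfl⟩ := Submodule.mem_sup.1 ht
    rw [← hts, ← map_smul, Submodule.mkQ_apply, Submodule.Quotient.mk_eq_zero, smul_add]
    exact add_mem (hJK a ha j hj) (K.mul_mem_left a hy)
  obtain ⟨g, hg, l₀, hl₀⟩ := Fintype.not_linearIndependent_iff.1
    (fun h : LinearIndependent k fun l : Fin n => fun s : S => ρ (α l s) => by
      have := h.fintype_card_le_finrank
      rw [Fintype.card_fin, Module.finrank_fintype_fun_eq_card, Fintype.card_coe] at this
      omega)
  choose f hf using hρ
  refine hl₀ ?_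
  rw [← hf (g l₀)]
  refine hli (fun l => f (g l)) ?_ l₀
  rw [← Submodule.Quotient.mk_eq_zero, ← Submodule.mkQ_apply, map_sum]
  calc ∑ l, Submodule.mkQ K (f (g l) * r l)
      = ∑ l, f (g l) • ∑ s : S, α l s • (s : R ⧸ K) := by
        refine Finset.sum_congr rfl fun l _ => ?_
        rw [← smul_eq_mul, map_smul, hα]
    _ = ∑ s : S, (∑ l, f (g l) * α l s) • (s : R ⧸ K) := by
        simp only [Finset.smul_sum, Finset.sum_smul, mul_smul]
        exact Finset.sum_comm
    _ = 0 := by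
        refine Finset.sum_eq_zero fun s _ => hkill _ ?_ s
        rw [RingHom.mem_ker, map_sum]
        simpa [hf] using congrFun hg s

end InitialFormsOfIdeals

/-- In the situation of `Represents.eq_zero_of_mem_pow_succ`, the initial forms of degree `D` of
the elements of `𝔪 ^ (D + 1) + (y)` have a common factor, namely the initial form of `y`, because
the associated graded ring is a domain. -/
lemma exists_forall_dvd_of_mem_sup_span {R k : Type*} [CommRing R] [IsLocalRing R]
    [IsNoetherianRing R] [Field k] [Infinite k] {ρ : R →+* k} (hρ : Function.Surjective ρ) {M : ℕ}
    {x : Fin (M + 1) → R} (hx : Ideal.span (Set.range x) = RingHom.ker ρ)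
    (hht : (M + 1 : ℕ) ≤ (RingHom.ker ρ).height) {D : ℕ} {y : R} (hy : y ∈ RingHom.ker ρ) :
    ∃ Y : MvPolynomial (Fin (M + 1)) k, ¬ IsUnit Y ∧ ∀ F r, Represents ρ x D F r →
      r ∈ RingHom.ker ρ ^ (D + 1) ⊔ Ideal.span {y} → Y ∣ F := by
  classical
  by_cases hyD : y ∈ RingHom.ker ρ ^ (D + 1)
  · refine ⟨0, not_isUnit_zero, fun F r hF hr => ?_⟩
    rw [hF.eq_zero_of_mem_pow_succ hρ hx hht]
    rwa [sup_eq_left.2 ((Ideal.span_singleton_le_iff_mem _).2 hyD)] at hr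
  -- every element outside a power of `𝔪` has an order
  have horder : ∀ (a : R) (l : ℕ), a ∉ RingHom.ker ρ ^ l →
      ∃ e < l, a ∈ RingHom.ker ρ ^ e ∧ a ∉ RingHom.ker ρ ^ (e + 1) := by
    intro a l ha
    have hex : ∃ l, a ∉ RingHom.ker ρ ^ l := ⟨l, ha⟩
    have h0 : Nat.find hex ≠ 0 := by
      intro h0
      have := Nat.find_spec hex
      rw [h0, pow_zero, Ideal.one_eq_top] at this
      exact this Submodule.mem_top
    have hmin := Nat.find_min' hex ha
    refine ⟨Nat.find hex - 1, by omega, not_not.1 (Nat.find_min hex (by omega)), ?_⟩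
    rw [Nat.sub_add_cancel (by omega)]
    exact Nat.find_spec hex
  obtain ⟨e, heD, hye, hye'⟩ := horder y _ hyD
  obtain ⟨Y, hY⟩ := Represents.exists_of_mem_pow hx hye
  have hY0 : Y ≠ 0 := fun h => hye' ((h ▸ hY).mem_pow_succ hx)
  have he0 : e ≠ 0 := by
    rintro rfl
    rw [zero_add, pow_one] at hye'
    exact hye' hy
  refine ⟨Y, fun h => he0 (hY.isHomogeneous.eq_zero_of_isUnit h), fun F r hF hr => ?_⟩
  obtain ⟨b, hb, s, hs, hbs⟩ := Submodule.mem_sup.1 hr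
  obtain ⟨a, rfl⟩ := Ideal.mem_span_singleton'.1 hs
  have hF' : Represents ρ x D F (a * y) := hF.congr (by
    rw [← hbs, sub_add_cancel_right]
    exact neg_mem hb)
  have hay : a * y ∈ RingHom.ker ρ ^ D := hF'.mem_pow hx
  have ha : a ∈ RingHom.ker ρ ^ (D - e) := by
    by_contra ha
    obtain ⟨f, hfD, haf, haf'⟩ := horder a _ ha
    obtain ⟨A, hA⟩ := Represents.exists_of_mem_pow hx haf
    have hA0 : A ≠ 0 := fun h => haf' ((h ▸ hA).mem_pow_succ hx)
    exact mul_ne_zero hA0 hY0 ((hA.mul hx hY).eq_zero_of_mem_pow_succ hρ hx hht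
      (Ideal.pow_le_pow_right (by omega) hay))
  obtain ⟨A, hA⟩ := Represents.exists_of_mem_pow hx ha
  have hAY := hA.mul hx hY
  rw [Nat.sub_add_cancel (by omega)] at hAY
  have h0 := (hF'.sub hAY).eq_zero_of_mem_pow_succ hρ hx hht (by simp)
  exact ⟨A, by rw [sub_eq_zero.1 h0, mul_comm]⟩

section HyperplaneSection

variable {R R' k : Type*} [CommRing R] [CommRing R'] [Field k] {m : ℕ}

lemma eval_restrictHyp {A : Type*} [CommRing A] (c y : Fin m → A)
    (G : MvPolynomial (Fin (m + 1)) A) :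
    eval y (restrictHyp c G) = eval (Fin.snoc y (-∑ i, c i * y i) : Fin (m + 1) → A) G := by
  have : (eval y).comp (restrictHyp c).toRingHom =
      eval (Fin.snoc y (-∑ i, c i * y i) : Fin (m + 1) → A) := by
    apply MvPolynomial.ringHom_ext
    · intro a; simp
    · intro i
      refine Fin.lastCases ?_ (fun j => ?_) i
      · simp [restrictHyp_X_last]
      · simp
  exact DFunLike.congr_fun this G

variable {ρ : R →+* k} {ρ' : R' →+* k} {π : R →+* R'} {x : Fin (m + 1) → R} {c : Fin m → R}

/-- Passing to `R / (z)`, with `z = x_m + c_0 x_0 + ⋯ + c_{m-1} x_{m-1}`, restricts forms to the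
hyperplane `z = 0`. -/
lemma Represents.restrictHyp (hρ : ρ'.comp π = ρ)
    (hz : π (x (Fin.last m) + ∑ i, c i * x i.castSucc) = 0) {i : ℕ}
    {F : MvPolynomial (Fin (m + 1)) k} {r : R} (h : Represents ρ x i F r) :
    Represents ρ' (fun j => π (x j.castSucc)) i (restrictHyp (ρ ∘ c) F) (π r) := by
  obtain ⟨G, hG, rfl, hr⟩ := h
  refine ⟨_root_.restrictHyp (π ∘ c) (map π G), (hG.map π).restrictHyp _, ?_, ?_⟩
  · rw [map_restrictHyp, map_map, hρ, ← hρ]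
    rfl
  · have h1 : eval (fun j => π (x j.castSucc)) (_root_.restrictHyp (π ∘ c) (map π G)) =
        π (eval x G) := by
      rw [eval_restrictHyp, map_eval]
      congr 2
      ext l
      refine Fin.lastCases ?_ (fun j => ?_) l
      · simp only [Fin.snoc_last, Function.comp_apply]
        rw [map_add, map_sum, add_eq_zero_iff_eq_neg] at hz
        rw [hz]
        simp only [map_mul]
      · simp
    rw [h1, ← map_sub]
    have h2 : (RingHom.ker ρ).map π ≤ RingHom.ker ρ' := by
      rw [Ideal.map_le_iff_le_comap]
      intro a ha
      rw [Ideal.mem_comap, RingHom.mem_ker, ← RingHom.comp_apply, hρ]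
      exact ha
    refine Ideal.pow_right_mono h2 _ ?_
    rw [← Ideal.map_pow]
    exact Ideal.mem_map_of_mem π hr

lemma span_range_castSucc_eq_ker (hρ : ρ'.comp π = ρ) (hπ : Function.Surjective π)
    (hz : π (x (Fin.last m) + ∑ i, c i * x i.castSucc) = 0)
    (hx : Ideal.span (Set.range x) = RingHom.ker ρ) :
    Ideal.span (Set.range fun j : Fin m => π (x j.castSucc)) = RingHom.ker ρ' := by
  apply le_antisymm
  · rw [Ideal.span_le]
    rintro _ ⟨j, rfl⟩
    have : x j.castSucc ∈ RingHom.ker ρ := hx ▸ Ideal.subset_span ⟨_, rfl⟩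
    rwa [SetLike.mem_coe, RingHom.mem_ker, ← RingHom.comp_apply, hρ]
  · intro s hs
    obtain ⟨r, rfl⟩ := hπ s
    have hr : r ∈ RingHom.ker ρ := by
      rwa [RingHom.mem_ker, ← RingHom.comp_apply, hρ] at hs
    rw [← hx] at hr
    have h1 := Ideal.mem_map_of_mem π hr
    rw [Ideal.map_span] at h1
    refine Ideal.span_le.2 ?_ h1
    rintro _ ⟨_, ⟨l, rfl⟩, rfl⟩
    refine Fin.lastCases ?_ (fun j => Ideal.subset_span ⟨j, rfl⟩) l
    rw [map_add, map_sum, add_eq_zero_iff_eq_neg] at hz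
    rw [hz, SetLike.mem_coe, neg_mem_iff]
    refine Ideal.sum_mem _ fun j _ => ?_
    rw [map_mul]
    exact Ideal.mul_mem_left _ _ (Ideal.subset_span ⟨j, rfl⟩)

end HyperplaneSection

/-- An element of the maximal ideal that lies in no minimal prime of `J` is a parameter on
`R / J`. -/
lemma isParameterOnQuotient_of_notMem_minimalPrimes {R : Type*} [CommRing R] [IsLocalRing R]
    [IsNoetherianRing R] {J : Ideal R} {z : R} (hz : z ∈ IsLocalRing.maximalIdeal R)
    (h : ∀ P ∈ J.minimalPrimes, z ∉ P) : IsParameterOnQuotient J z := by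
  have h1 := supportDim_quotSMulTop_succ_eq_of_notMem_minimalPrimes_of_mem_maximalIdeal
    (M := R ⧸ J) (by rwa [Ideal.annihilator_quotient]) hz
  have h2 : support R (R ⧸ (J ⊔ Ideal.span {z})) = support R (QuotSMulTop z (R ⧸ J)) := by
    rw [support_quotSMulTop, support_eq_zeroLocus, support_eq_zeroLocus,
      Ideal.annihilator_quotient, Ideal.annihilator_quotient, PrimeSpectrum.zeroLocus_sup,
      PrimeSpectrum.zeroLocus_span]
  refine ⟨hz, ?_⟩
  rw [← supportDim_quotient_eq_ringKrullDim, ← supportDim_quotient_eq_ringKrullDim, ← h1,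
    supportDim, supportDim, h2]

/-! ### Elements of the maximal ideal with generic initial form -/

lemma ker_eq_map_ker {R R' k : Type*} [CommRing R] [CommRing R'] [Field k] {ρ : R →+* k}
    {ρ' : R' →+* k} {π : R →+* R'} (hρ : ρ'.comp π = ρ) (hπ : Function.Surjective π) :
    RingHom.ker ρ' = (RingHom.ker ρ).map π := by
  rw [← hρ, ← RingHom.comap_ker, Ideal.map_comap_of_surjective π hπ]

/-- The conclusions on `z` follow from the corresponding statements on the restriction of the
initial forms of `J` to the hyperplane `z = 0`. -/
lemma hyperplaneSection_of_restrictHyp {R k : Type*} [CommRing R] [IsLocalRing R]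
    [IsNoetherianRing R] [Field k] [Infinite k] {ρ : R →+* k} (hρ : Function.Surjective ρ) {M : ℕ}
    {x : Fin (M + 1 + 1) → R} (hx : Ideal.span (Set.range x) = RingHom.ker ρ)
    (hht : (M + 1 + 1 : ℕ) ≤ (RingHom.ker ρ).height) {D n : ℕ} {J : Ideal R}
    (hJ : J ≤ RingHom.ker ρ ^ D) {c : Fin (M + 1) → R}
    (hgcd : ∀ Y, (∀ F ∈ initialForms hρ x J D, Y ∣ restrictHyp (ρ ∘ c) F) → IsUnit Y)
    {v : Fin n → MvPolynomial (Fin (M + 1 + 1)) k} (hv : ∀ i, v i ∈ initialForms hρ x J D)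
    (hli : LinearIndependent k fun i => restrictHyp (ρ ∘ c) (v i))
    {z : R} (hz : z = x (Fin.last (M + 1)) + ∑ i, c i * x i.castSucc) :
    n ≤ muMod J (RingHom.ker ρ ^ (D + 1) ⊔ Ideal.span {z}) ∧
      ∀ y ∈ RingHom.ker ρ, ¬ J ≤ RingHom.ker ρ ^ (D + 1) ⊔ Ideal.span {y, z} := by
  have hxm : ∀ j, x j ∈ RingHom.ker ρ := fun j => hx ▸ Ideal.subset_span ⟨j, rfl⟩
  have hzm : z ∈ RingHom.ker ρ :=
    hz ▸ add_mem (hxm _) (Ideal.sum_mem _ fun i _ => Ideal.mul_mem_left _ _ (hxm _))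
  -- the quotient by `z`, with its residue map
  set π : R →+* R ⧸ Ideal.span {z} := Ideal.Quotient.mk _ with hπdef
  have hπ : Function.Surjective π := Ideal.Quotient.mk_surjective
  let ρ' : R ⧸ Ideal.span {z} →+* k := Ideal.Quotient.lift _ ρ fun a ha =>
    (Ideal.span_singleton_le_iff_mem _).2 hzm ha
  have hρ' : ρ'.comp π = ρ := Ideal.Quotient.lift_comp_mk _ _ _
  have hρ's : Function.Surjective ρ' := Function.Surjective.of_comp (g := π) (by
    rw [← RingHom.coe_comp, hρ']; exact hρ)
  have hmker : (RingHom.ker ρ).IsMaximal := RingHom.ker_isMaximal_of_surjective ρ hρ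
  have : Nontrivial (R ⧸ Ideal.span {z}) := Ideal.Quotient.nontrivial_iff.2 fun h =>
    hmker.ne_top (top_le_iff.1 (h ▸ (Ideal.span_singleton_le_iff_mem _).2 hzm))
  have : IsLocalRing (R ⧸ Ideal.span {z}) := IsLocalRing.of_surjective' π hπ
  have hz0 : π (x (Fin.last (M + 1)) + ∑ i, c i * x i.castSucc) = 0 := by
    rw [← hz]
    exact Ideal.Quotient.eq_zero_iff_mem.2 (Ideal.mem_span_singleton_self z)
  have hx' := span_range_castSucc_eq_ker hρ' hπ hz0 hx
  have hker := ker_eq_map_ker hρ' hπ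
  have hht' : (M + 1 : ℕ) ≤ (RingHom.ker ρ').height := by
    have h1 := hht.trans (Ideal.height_le_height_add_one_of_mem hzm)
    rw [← hπdef, ← hker, Nat.cast_add_one] at h1
    exact (ENat.add_le_add_iff_right ENat.one_ne_top).1 h1
  have hres : ∀ {F r}, Represents ρ x D F r →
      Represents ρ' (fun j => π (x j.castSucc)) D (restrictHyp (ρ ∘ c) F) (π r) :=
    fun h => h.restrictHyp hρ' hz0
  have hpow : ∀ {r}, r ∈ RingHom.ker ρ ^ (D + 1) → π r ∈ RingHom.ker ρ' ^ (D + 1) := by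
    intro r hr
    rw [hker, ← Ideal.map_pow]
    exact Ideal.mem_map_of_mem π hr
  constructor
  · choose r hrJ hr using fun i => mem_initialForms.1 (hv i)
    refine le_muMod_of_forall_sum_mem hρ (fun a ha j hj => Ideal.mem_sup_left ?_) hrJ
      fun a ha => ?_
    · rw [pow_succ']
      exact Ideal.mul_mem_mul ha (hJ hj)
    · have h1 := hres (Represents.sum Finset.univ fun l _ => (hr l).C_mul (a l))
      have h2 : π (∑ l, a l * r l) ∈ RingHom.ker ρ' ^ (D + 1) := by
        obtain ⟨b, hb, s, hs, hbs⟩ := Submodule.mem_sup.1 ha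
        rw [← hbs, map_add, Ideal.Quotient.eq_zero_iff_mem.2 hs, add_zero]
        exact hpow hb
      have h3 := h1.eq_zero_of_mem_pow_succ hρ's hx' hht' h2
      refine Fintype.linearIndependent_iff.1 hli (fun l => ρ (a l)) ?_
      simpa only [map_sum, map_mul, restrictHyp_C, ← smul_eq_C_mul, map_smul] using h3
  · intro y hy hJy
    obtain ⟨Y, hYu, hY⟩ := exists_forall_dvd_of_mem_sup_span hρ's hx' hht' (D := D) (y := π y)
      (by rw [hker]; exact Ideal.mem_map_of_mem π hy)
    refine hYu (hgcd Y ?_)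
    rintro F ⟨j, hj, hF⟩
    refine hY _ _ (hres hF) ?_
    obtain ⟨b, hb, s, hs, hbs⟩ := Submodule.mem_sup.1 (hJy hj)
    obtain ⟨a₁, a₂, rfl⟩ := Ideal.mem_span_pair.1 hs
    rw [← hbs, map_add, map_add, map_mul, map_mul,
      (Ideal.Quotient.eq_zero_iff_mem.2 (Ideal.mem_span_singleton_self z) : π z = 0), mul_zero,
      add_zero]
    exact add_mem (Ideal.mem_sup_left (hpow hb))
      (Ideal.mem_sup_right (Ideal.mul_mem_left _ _ (Ideal.mem_span_singleton_self _)))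

section Hypotheses

variable {R k : Type*} [CommRing R] [Field k] {N : ℕ} {ρ : R →+* k} {x : Fin N → R}

/-- If no `(y) + 𝔪 ^ (D + 1)` with `y ∈ 𝔪` contains `J`, the initial forms of `J` of degree `D` have
no common factor. -/
lemma exists_mem_initialForms_not_dvd (hρ : Function.Surjective ρ)
    (hx : Ideal.span (Set.range x) = RingHom.ker ρ) {J : Ideal R} {D : ℕ}
    (hJ : J ≤ RingHom.ker ρ ^ D)
    (hJy : ∀ y ∈ RingHom.ker ρ, ¬ J ≤ Ideal.span {y} ⊔ RingHom.ker ρ ^ (D + 1))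
    {e : ℕ} (he : e ≠ 0) {Y : MvPolynomial (Fin N) k} (hY : Y.IsHomogeneous e) :
    ∃ F ∈ initialForms hρ x J D, ¬ Y ∣ F := by
  by_contra! h
  obtain ⟨y, hy, hYy⟩ := Represents.exists_of_isHomogeneous hx hρ hY
  refine hJy y (Ideal.pow_le_self he hy) fun j hj => ?_
  obtain ⟨F, hF⟩ := Represents.exists_of_mem_pow hx (hJ hj)
  rcases eq_or_ne F 0 with rfl | hF0
  · exact Ideal.mem_sup_right (hF.mem_pow_succ hx)
  obtain ⟨G, rfl⟩ := h F ⟨j, hj, hF⟩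
  obtain ⟨b, rfl, hG⟩ := hY.of_mul_left hF.isHomogeneous (left_ne_zero_of_mul hF0)
    (right_ne_zero_of_mul hF0)
  obtain ⟨g, -, hg⟩ := Represents.exists_of_isHomogeneous hx hρ hG
  have h1 := hF.sub (hYy.mul hx hg)
  rw [sub_self] at h1
  rw [← add_sub_cancel (y * g) j]
  exact add_mem (Ideal.mem_sup_left (Ideal.mul_mem_right _ _ (Ideal.mem_span_singleton_self y)))
    (Ideal.mem_sup_right (h1.mem_pow_succ hx))

lemma exists_sum_pow_notMem_initialForms (hρ : Function.Surjective ρ)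
    (hx : Ideal.span (Set.range x) = RingHom.ker ρ) {J : Ideal R} {D : ℕ} {r : R}
    (hr : r ∈ RingHom.ker ρ) (hrD : r ^ D ∉ J ⊔ RingHom.ker ρ ^ (D + 1)) :
    ∃ a : Fin N → k, (∑ i, C (a i) * X i) ^ D ∉ initialForms hρ x J D := by
  rw [← hx, Ideal.mem_span_range_iff_exists_fun] at hr
  obtain ⟨a, rfl⟩ := hr
  refine ⟨fun i => ρ (a i), ?_⟩
  rintro ⟨j, hj, h⟩
  have h1 : Represents ρ x D ((∑ i, C (ρ (a i)) * X i) ^ D) ((∑ i, a i * x i) ^ D) := by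
    refine ⟨(∑ i, C (a i) * X i) ^ D, ?_, by simp, by simp⟩
    simpa using (IsHomogeneous.sum (σ := Fin N) Finset.univ (fun i => C (a i) * X i) 1
      fun _ _ => isHomogeneous_C_mul_X _ _).pow D
  have h2 := h1.sub h
  rw [sub_self] at h2
  apply hrD
  rw [← add_sub_cancel j ((∑ i, a i * x i) ^ D)]
  exact add_mem (Ideal.mem_sup_left hj) (Ideal.mem_sup_right (h2.mem_pow_succ hx))

lemma represents_monicForm {m : ℕ} {x : Fin (m + 1) → R} (c : Fin m → R) :
    Represents ρ x 1 (monicForm (ρ ∘ c)) (x (Fin.last m) + ∑ i, c i * x i.castSucc) :=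
  ⟨monicForm c, isHomogeneous_monicForm c, map_monicForm ρ c, by simp [monicForm]⟩

end Hypotheses

/-- A generic element of the maximal ideal lies in no minimal prime of `J`, unless the maximal ideal
is one: by Nakayama's lemma, the linear initial forms of a nonmaximal prime form a proper
subspace. -/
lemma generic_forall_minimalPrimes_notMem {R k : Type*} [CommRing R] [IsLocalRing R]
    [IsNoetherianRing R] [Field k] {ρ : R →+* k} (hρ : Function.Surjective ρ) {m : ℕ}
    {x : Fin (m + 1) → R} (hx : Ideal.span (Set.range x) = RingHom.ker ρ) {J : Ideal R}
    (hJ : RingHom.ker ρ ∉ J.minimalPrimes) :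
    Generic fun c : Fin m → k => ∀ P ∈ J.minimalPrimes, ∀ c' : Fin m → R, ρ ∘ c' = c →
      x (Fin.last m) + ∑ i, c' i * x i.castSucc ∉ P := by
  refine Generic.forall_mem_finite (Ideal.finite_minimalPrimes_of_isNoetherianRing _ J)
    fun P hP => ?_
  let L : (Fin (m + 1) → k) →ₗ[k] MvPolynomial (Fin (m + 1)) k := Fintype.linearCombination k X
  refine (generic_snoc_one_notMem ((initialForms hρ x P 1).comap L) fun htop => ?_).mono
    fun c hc c' hc' hzP => hc ?_
  · have hPm : P ≠ RingHom.ker ρ := fun h => hJ (h ▸ hP)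
    have hker := ker_eq_maximalIdeal hρ
    have hPle : P ≤ RingHom.ker ρ := by
      rw [hker]
      exact IsLocalRing.le_maximalIdeal hP.1.1.ne_top
    refine hPm (le_antisymm hPle ?_)
    refine Submodule.le_of_le_smul_of_le_jacobson_bot (I := RingHom.ker ρ)
      (IsNoetherian.noetherian _) (by rw [hker, IsLocalRing.jacobson_eq_maximalIdeal _ bot_ne_top])
      ?_
    nth_rw 1 [← hx]
    rw [Ideal.span_le]
    rintro _ ⟨j, rfl⟩
    have hj : Pi.single j 1 ∈ (initialForms hρ x P 1).comap L := htop ▸ Submodule.mem_top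
    obtain ⟨r, hr, h⟩ := hj
    have h1 : Represents ρ x 1 (L (Pi.single j 1)) (x j) :=
      ⟨X j, isHomogeneous_X _ _, by simp [L, Fintype.linearCombination_apply_single], by simp⟩
    have h2 := h1.sub h
    rw [sub_self] at h2
    have h3 := h2.mem_pow_succ hx
    rw [← add_sub_cancel r (x j)]
    refine add_mem (Submodule.mem_sup_left hr) (Submodule.mem_sup_right ?_)
    rwa [smul_eq_mul, ← pow_two]
  · refine ⟨_, hzP, ?_⟩
    have hL : L (Fin.snoc c 1) = monicForm (ρ ∘ c') := by
      rw [hc', monicForm_eq_sum]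
      simp only [L, Fintype.linearCombination_apply, smul_eq_C_mul]
    rw [hL]
    exact represents_monicForm c'

theorem mainTheorem8 {R : Type*} [CommRing R] [IsRegularLocalRing R]
    [IsAdicComplete (IsLocalRing.maximalIdeal R) R]
    [Infinite (IsLocalRing.ResidueField R)]
    (d n : ℕ) (hd : ringKrullDim R = d) (hd3 : 3 ≤ d) (hn : 3 ≤ n)
    (J : Ideal R) (hJ : IsPerfectIdeal J) (hheight : J.height = 3)
    (hJle : J ≤ IsLocalRing.maximalIdeal R ^ (n - 1))
    (hmu : n ≤ muMod J (IsLocalRing.maximalIdeal R ^ n))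
    (hJy : ∀ y ∈ IsLocalRing.maximalIdeal R,
      ¬ J ≤ Ideal.span {y} ⊔ IsLocalRing.maximalIdeal R ^ n)
    (hcases : n < d ∨
      (d = n ∧ n < muMod J (IsLocalRing.maximalIdeal R ^ n)) ∨
      (d = n ∧ ¬ ({s : R | ∃ r ∈ IsLocalRing.maximalIdeal R, s = r ^ (n - 1)} ⊆
        ((J ⊔ IsLocalRing.maximalIdeal R ^ n : Ideal R) : Set R)))) :
    ∃ z ∈ IsLocalRing.maximalIdeal R, z ∉ IsLocalRing.maximalIdeal R ^ 2 ∧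
      n ≤ muMod J (IsLocalRing.maximalIdeal R ^ n ⊔ Ideal.span {z}) ∧
      (∀ y ∈ IsLocalRing.maximalIdeal R,
        ¬ J ≤ IsLocalRing.maximalIdeal R ^ n ⊔ Ideal.span {y, z}) ∧
      (d ≠ 3 → IsParameterOnQuotient J z) := by
  obtain ⟨D, rfl⟩ : ∃ D, n = D + 1 := ⟨n - 1, by omega⟩
  obtain ⟨M, rfl⟩ : ∃ M, d = M + 1 + 1 := ⟨d - 2, by omega⟩
  rw [Nat.add_sub_cancel] at hJle hcases
  obtain ⟨k, hk, ρ, hρ, hinf⟩ : ∃ (k : Type _) (_ : Field k) (ρ : R →+* k),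
      Function.Surjective ρ ∧ Infinite k :=
    ⟨IsLocalRing.ResidueField R, inferInstance, IsLocalRing.residue R,
      IsLocalRing.residue_surjective, inferInstance⟩
  have hdim : (IsLocalRing.maximalIdeal R).height = (M + 1 + 1 : ℕ) := by
    have := IsLocalRing.maximalIdeal_height_eq_ringKrullDim (R := R)
    rw [hd] at this
    exact_mod_cast this
  -- a regular system of parameters
  obtain ⟨x, hx⟩ : ∃ x : Fin (M + 1 + 1) → R,
      Ideal.span (Set.range x) = IsLocalRing.maximalIdeal R := by
    have hfg : (IsLocalRing.maximalIdeal R).FG := IsNoetherian.noetherian _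
    have hfin := Submodule.FG.finite_generators hfg
    have hcard : hfin.toFinset.card = M + 1 + 1 := by
      rw [← Set.ncard_eq_toFinset_card _ hfin, Submodule.FG.generators_ncard hfg]
      have := IsRegularLocalRing.spanFinrank_maximalIdeal (R := R)
      rw [hd] at this
      exact_mod_cast this
    refine ⟨fun i => ((hfin.toFinset.equivFinOfCardEq hcard).symm i : R), ?_⟩
    refine Eq.trans ?_ (Submodule.span_generators (IsLocalRing.maximalIdeal R))
    congr 1
    ext r
    constructor
    · rintro ⟨i, rfl⟩
      exact hfin.mem_toFinset.1 (Subtype.prop _)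
    · intro hr
      exact ⟨hfin.toFinset.equivFinOfCardEq hcard ⟨r, hfin.mem_toFinset.2 hr⟩, by simp⟩
  have hnotmin : M + 1 + 1 ≠ 3 → IsLocalRing.maximalIdeal R ∉ J.minimalPrimes := by
    intro hne hmin
    apply hne
    have h1 : (IsLocalRing.maximalIdeal R).height ≤ J.height := by
      rw [J.height_eq_inf_minimalPrimes]
      refine le_iInf₂ fun P hP => Ideal.height_mono ?_
      exact hmin.2 hP.1 (IsLocalRing.le_maximalIdeal hP.1.1.ne_top)
    rw [hdim, hheight] at h1
    have h2 : M + 1 + 1 ≤ 3 := by exact_mod_cast h1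
    omega
  have hparam : M + 1 + 1 ≠ 3 → ∀ z ∈ IsLocalRing.maximalIdeal R,
      (∀ P ∈ J.minimalPrimes, z ∉ P) → IsParameterOnQuotient J z :=
    fun _ _ hz h => isParameterOnQuotient_of_notMem_minimalPrimes hz h
  have hht := hdim.ge
  rw [← ker_eq_maximalIdeal hρ] at *
  have hrank := muMod_le_finrank_initialForms hρ hx hJle
  have hgen := generic_restrictHyp_linearSystem (m := M + 1) (n := D + 1) (D := D) (by omega)
    (by omega) (fun F hF => isHomogeneous_of_mem_initialForms hF) (hmu.trans hrank)
    (fun e he Y hY => exists_mem_initialForms_not_dvd hρ hx hJle hJy he hY) (by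
      rcases hcases with h | ⟨h, h'⟩ | ⟨h, h'⟩
      · exact Or.inl (by omega)
      · exact Or.inr (Or.inl ⟨h.symm, h'.trans_le hrank⟩)
      · refine Or.inr (Or.inr ⟨h.symm, ?_⟩)
        obtain ⟨_, ⟨r, hr, rfl⟩, hrD⟩ := Set.not_subset.1 h'
        exact exists_sum_pow_notMem_initialForms hρ hx hr hrD)
  have hgen' : Generic fun c : Fin (M + 1) → k => M + 1 + 1 ≠ 3 → ∀ P ∈ J.minimalPrimes,
      ∀ c' : Fin (M + 1) → R, ρ ∘ c' = c →
        x (Fin.last (M + 1)) + ∑ i, c' i * x i.castSucc ∉ P := by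
    by_cases h3 : M + 1 + 1 = 3
    · exact hgen.mono fun c _ h => absurd h3 h
    · exact (generic_forall_minimalPrimes_notMem hρ hx (hnotmin h3)).mono fun c hc _ => hc
  obtain ⟨c, ⟨hgcd, v, hv, hli⟩, hc⟩ := (hgen.and hgen').exists_point
  obtain ⟨c', rfl⟩ : ∃ c', ρ ∘ c' = c := ⟨fun i => (hρ (c i)).choose, funext fun i =>
    (hρ (c i)).choose_spec⟩
  have hzm : x (Fin.last (M + 1)) + ∑ i, c' i * x i.castSucc ∈ RingHom.ker ρ := by
    simpa using (represents_monicForm (ρ := ρ) (x := x) c').mem_pow hx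
  obtain ⟨h1, h2⟩ := hyperplaneSection_of_restrictHyp hρ hx hht hJle hgcd hv hli rfl
  exact ⟨_, hzm, fun hz2 => monicForm_ne_zero _
    ((represents_monicForm c').eq_zero_of_mem_pow_succ hρ hx hht hz2), h1, h2,
    fun h3 => hparam h3 _ hzm fun P hP => hc h3 P hP c' rfl⟩
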